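/- **Generalized swap test.** There is a universal constant $C>0$ such that for all integers $n\ge 1$, $m\ge 0$ and all $\epsilon,\delta\in(0,1]$ there is a randomized quantum algorithm $\mathcal A$ with the following property. Let $|x\rangle,|y\rangle$ be $n$-qubit states with $\langle x|y\rangle\in\mathbb R$ (in particular, two states whose amplitudes are real up to a common global phase), and let $P_x,P_y$ be quantum circuits on $n$ qubits which prepare them from $|0\rangle^{\otimes n}$, each in time at most $T_{\mathrm{in}}$. Then, for every outcome $r$ of the coin flips of $\mathcal A$, the algorithm $\mathcal A$ applied to $P_x,P_y$ runs in time at most $$C\,\frac{T_{\mathrm{in}}}{\epsilon\,\delta},$$ that is, in time $O(T_{\mathrm{in}}/\epsilon)$ for any fixed $\delta$. Moreover, there are real numbers $s_r$, one for each outcome $r$, with $|\langle x|y\rangle-s_r|\le\epsilon$ for all $r$, such that for every function $f:\mathbb R\to\{0,1\}^m$ the algorithm achieves $$\frac1{\sqrt2}\big(|0\rangle|x\rangle+|1\rangle|y\rangle\big)|0^m\rangle|0\cdots0\rangle\;\mapsto\;\frac1{\sqrt2}\big(|0\rangle|x\rangle+|1\rangle|y\rangle\big)|f(s_r)\rangle|0\cdots0\rangle$$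 up to mean square error $\delta$: if $|\Omega_r\rangle$ denotes the final state of the algorithm for the outcome $r$, and $|\Psi_r\rangle$ the state on the right, then $\mathbb E_r\big\||\Omega_r\rangle-|\Psi_r\rangle\big\|^2\le\delta$. In particular, the algorithm produces the state on the right with success probability at least $1-\delta$, i.e. $\mathbb E_r|\langle\Psi_r|\Omega_r\rangle|^2\ge1-\delta$. Here a circuit is a list of one-qubit unitaries with any number of control qubits, a gate with $c$ controls costing $c+1$ time units; the time in which a circuit prepares an $n$-qubit state is $n$ (initialisation of the qubits) plus the cost of its gates. The algorithm flips finitely many fair coins and then, depending on their outcome, performs a list of instructions on the input, output and ancilla qubits. Each instruction is a gate, a (possibly controlled) run of $P_x$, $P_y$, $P_x^{-1}$ or $P_y^{-1}$ as a black box, or an evaluation $|k\rangle|z\rangle\mapsto|k\rangle|z\oplus f(d(k))\rangle$ of $f$ at the real number $d(k)$ represented by the ancilla content $k$, for an encoding $d$ fixed by the algorithm. Its time counts the coins, the ancilla qubits, all gates (those inside the runs of the preparation circuits and of their inverses included), and one unit for each evaluation of $f$. The algorithm does not depend on $x,y,P_x,P_y,T_{\mathrm{in}}$ or $f$. -/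

import Mathlib

/-- Pure states (vectors) of a quantum register whose qubits are labelled by `W`; the computational
basis is indexed by the bit assignments `W → Bool`. -/
abbrev QState (W : Type) [Fintype W] : Type := EuclideanSpace ℂ (W → Bool)

/-- A one-qubit unitary on the qubit `target`, controlled by the (possibly empty) set `controls`. -/
structure QGate (W : Type) where
  controls : Finset W
  target : W
  target_notMem : target ∉ controls
  mat : Matrix.unitaryGroup Bool ℂ

namespace QGate

/-- A one-qubit gate costs one time unit, and every control qubit costs one more. -/
def cost {W : Type} (g : QGate W) : ℕ := g.controls.card + 1

/-- The action of a controlled one-qubit gate on a state. -/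
noncomputable def act {W : Type} [Fintype W] [DecidableEq W] (g : QGate W) (v : QState W) :
    QState W :=
  WithLp.toLp 2 fun b =>
    if ∀ c ∈ g.controls, b c = true then
      ∑ β : Bool, (g.mat : Matrix Bool Bool ℂ) (b g.target) β * v (Function.update b g.target β)
    else v b

/-- The inverse gate. -/
noncomputable def inverse {W : Type} (g : QGate W) : QGate W where
  controls := g.controls
  target := g.target
  target_notMem := g.target_notMem
  mat := g.mat⁻¹

/-- The gate `g`, placed on the qubits `e` of a larger register and moreover controlled by the
further qubits `ctrl`. -/
def place {V W : Type} [DecidableEq W] (e : V ↪ W) (ctrl : Finset W)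
    (h : ∀ i, e i ∉ ctrl) (g : QGate V) : QGate W where
  controls := ctrl ∪ g.controls.map e
  target := e g.target
  target_notMem := by
    intro hm
    rcases Finset.mem_union.mp hm with hm | hm
    · exact h _ hm
    · exact g.target_notMem ((Finset.mem_map' e).mp hm)
  mat := g.mat

end QGate

/-- Quantum circuits; the head of the list is performed first. -/
abbrev QCircuit (W : Type) : Type := List (QGate W)

namespace QCircuit

/-- The total cost of the gates of a circuit. -/
def cost {W : Type} (P : QCircuit W) : ℕ := (P.map QGate.cost).sum

/-- Running a circuit on a state. -/
noncomputable def run {W : Type} [Fintype W] [DecidableEq W] (P : QCircuit W) (v : QState W) :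
    QState W :=
  P.foldl (fun u g => g.act u) v

/-- The inverse circuit. -/
noncomputable def inverse {W : Type} (P : QCircuit W) : QCircuit W :=
  (P.map QGate.inverse).reverse

/-- The circuit `P`, placed on the qubits `e` of a larger register, all of its gates being moreover
controlled by the qubits `ctrl`. -/
def place {V W : Type} [DecidableEq W] (e : V ↪ W) (ctrl : Finset W)
    (h : ∀ i, e i ∉ ctrl) (P : QCircuit V) : QCircuit W :=
  P.map (QGate.place e ctrl h)

/-- The time in which a circuit on `n` qubits prepares a state from `|0…0⟩`: one unit for the
initialisation of each qubit, plus the cost of the gates. -/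
def prepTime {n : ℕ} (P : QCircuit (Fin n)) : ℕ := n + cost P

/-- `P` prepares the state `x` from `|0…0⟩`. -/
def Prepares {n : ℕ} (P : QCircuit (Fin n)) (x : QState (Fin n)) : Prop :=
  run P (EuclideanSpace.single (fun _ => false) 1) = x

end QCircuit

namespace SwapTest

/-- The qubits of the algorithm: the flag qubit and the `n` data qubits, which carry the input state
`(|0⟩|x⟩ + |1⟩|y⟩)/√2`, the `m` qubits of the output register, and `a` ancilla qubits. -/
inductive Wire (n m a : ℕ) : Type
  | flag : Wire n m a
  | data : Fin n → Wire n m a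
  | out : Fin m → Wire n m a
  | anc : Fin a → Wire n m a
  deriving DecidableEq, Fintype

/-- The instructions that an algorithm may use.
* `gate g`: an elementary gate;
* `call`: a run of the given preparation circuit of `|x⟩` (if `which = false`) or of `|y⟩`
  (if `which = true`), or of its inverse (if `inv = true`), on the qubits `reg`, controlled by `ctrl`;
* `eval dec`: the evaluation of the function `f` at the number `dec k` that is represented by the
  content `k` of the ancilla qubits, `|k⟩|z⟩ ↦ |k⟩|z ⊕ f (dec k)⟩`.
The preparation circuits and the function are not part of the instruction: an algorithm can use them
as black boxes only. -/
inductive Instr (n m a : ℕ) : Type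
  | gate (g : QGate (Wire n m a)) : Instr n m a
  | call (which inv : Bool) (ctrl : Finset (Wire n m a)) (reg : Fin n ↪ Wire n m a)
      (h : ∀ i, reg i ∉ ctrl) : Instr n m a
  | eval (dec : (Fin a → Bool) → ℝ) : Instr n m a

/-- The circuit that a `call` stands for. -/
noncomputable def callCircuit {n m a : ℕ} (Px Py : QCircuit (Fin n)) (which inv : Bool)
    (ctrl : Finset (Wire n m a)) (reg : Fin n ↪ Wire n m a) (h : ∀ i, reg i ∉ ctrl) :
    QCircuit (Wire n m a) :=
  let P := if which then Py else Px
  QCircuit.place reg ctrl h (if inv then P.inverse else P)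

/-- The basis permutation `|k⟩|z⟩ ↦ |k⟩|z ⊕ f (dec k)⟩` on bit assignments. -/
def evalBits {n m a : ℕ} (f : ℝ → (Fin m → Bool)) (dec : (Fin a → Bool) → ℝ)
    (b : Wire n m a → Bool) : Wire n m a → Bool
  | .flag => b .flag
  | .data i => b (.data i)
  | .out j => xor (b (.out j)) (f (dec fun k => b (.anc k)) j)
  | .anc k => b (.anc k)

namespace Instr

/-- The action of an instruction on a state. The map `evalBits f dec` is its own inverse. -/
noncomputable def act {n m a : ℕ} (Px Py : QCircuit (Fin n)) (f : ℝ → (Fin m → Bool)) :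
    Instr n m a → QState (Wire n m a) → QState (Wire n m a)
  | .gate g, v => g.act v
  | .call which inv ctrl reg h, v => (callCircuit Px Py which inv ctrl reg h).run v
  | .eval dec, v => WithLp.toLp 2 fun b => v (evalBits f dec b)

/-- The time of an instruction: elementary gates are counted, those of the called preparation
circuits included; an evaluation of `f` counts as one step. -/
noncomputable def cost {n m a : ℕ} (Px Py : QCircuit (Fin n)) : Instr n m a → ℕ
  | .gate g => g.cost
  | .call which inv ctrl reg h => (callCircuit Px Py which inv ctrl reg h).cost
  | .eval _ => 1

end Instr

/-- A randomized quantum algorithm: it flips `coins` fair coins and then performs the list of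
instructions determined by their outcome, with `anc` ancilla qubits. -/
structure Algorithm (n m : ℕ) where
  coins : ℕ
  anc : ℕ
  prog : (Fin coins → Bool) → List (Instr n m anc)

namespace Algorithm

/-- The running time when the coins show `r`: coin flips, initialisation of the ancilla qubits,
and instructions. -/
noncomputable def time {n m : ℕ} (A : Algorithm n m) (Px Py : QCircuit (Fin n))
    (r : Fin A.coins → Bool) : ℕ :=
  A.coins + A.anc + ((A.prog r).map (Instr.cost Px Py)).sum

/-- The final state when the coins show `r`. -/
noncomputable def run {n m : ℕ} (A : Algorithm n m) (Px Py : QCircuit (Fin n))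
    (f : ℝ → (Fin m → Bool)) (r : Fin A.coins → Bool) (v : QState (Wire n m A.anc)) :
    QState (Wire n m A.anc) :=
  (A.prog r).foldl (fun u i => i.act Px Py f u) v

end Algorithm

/-- The state `(|0⟩|x⟩ + |1⟩|y⟩)/√2 ⊗ |z⟩ ⊗ |0…0⟩` with `z` in the output register and with the
ancilla qubits in `|0⟩`. -/
noncomputable def pairState {n m a : ℕ} (x y : QState (Fin n)) (z : Fin m → Bool) :
    QState (Wire n m a) :=
  WithLp.toLp 2 fun b =>
    if (∀ j, b (.out j) = z j) ∧ (∀ k, b (.anc k) = false) then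
      (1 / (Real.sqrt 2 : ℂ)) *
        (if b .flag = true then y (fun i => b (.data i)) else x (fun i => b (.data i)))
    else 0

end SwapTest

/-! Write ψ for the input vector, X for the NOT of the flag and c for the real number ⟨x|y⟩. Then
⟨ψ|Xψ⟩ = c, and G = (1 − 2|ψ⟩⟨ψ|)X preserves the span of ψ and Xψ, where its eigenvalues satisfy μ²
= −2cμ − 1. They have modulus 1 and real part −c, and ψ is a sum of two eigenvectors
(`exists_eigenvectors`). A controlled G needs only a bounded number of runs of the preparation
circuits and O(n) further gate cost (`runList_reflection`), so phase estimation with t bits finds c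
to precision about 2^(-t) in time O(2^t · T).

Two difficulties remain. First, an outcome at distance u (in units of 2^(-t)) from the truth has
probability of order u^(-2), so for one round the natural bound on the mean error carries a
logarithmic factor. With the median of three rounds, the error is at most the geometric mean of the
errors of two rounds. Each round then contributes only a factor √u, and u^(-3/2) is summable: the
mean error is O(2^(-t)) (`sum_estimate_le`).

Second, f is arbitrary, so a close estimate is useless unless it gives exactly the same argument of
f. The estimate is therefore rounded to a grid of width ε whose shift is chosen by the coins. Among
M shifts, two numbers at distance d are separated by at most a fraction d/ε + 1/M of them
(`card_gridRound_ne_le`). Taking s_r to be the rounding of c itself, the averaged weight of the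
ancilla contents that yield a wrong argument is O(1/(2^t ε)) + 2^(-q) with q coins.

Running phase estimation backwards after the evaluation of f clears the ancillas, and unitarity
turns this weight into the mean square error (`norm_eval_sub_sq_le`, `error_swapTest_le`). It
suffices to take 2^t of order 1/(εδ) and 2^q of order 1/δ. -/

set_option linter.unusedSectionVars false

/-! ### Gates and circuits as unitary operators -/

namespace QGate

variable {W : Type} [Fintype W] [DecidableEq W]

theorem act_apply (g : QGate W) (v : QState W) (b : W → Bool) :
    g.act v b = if ∀ c ∈ g.controls, b c = true then
      ∑ β : Bool, (g.mat : Matrix Bool Bool ℂ) (b g.target) β * v (Function.update b g.target β)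
    else v b := rfl

theorem controls_update_iff (g : QGate W) (b : W → Bool) (β : Bool) :
    (∀ c ∈ g.controls, Function.update b g.target β c = true) ↔ ∀ c ∈ g.controls, b c = true := by
  refine forall₂_congr fun c hc => ?_
  rw [Function.update_of_ne]
  rintro rfl
  exact g.target_notMem hc

theorem inverse_inverse (g : QGate W) : g.inverse.inverse = g := by
  simp [inverse]

theorem inverse_mat (g : QGate W) :
    (g.inverse.mat : Matrix Bool Bool ℂ) = star (g.mat : Matrix Bool Bool ℂ) := rfl

theorem inverse_act_apply (g : QGate W) (v : QState W) (b : W → Bool) :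
    g.inverse.act v b = if ∀ c ∈ g.controls, b c = true then
      ∑ β : Bool, (starRingEnd ℂ) ((g.mat : Matrix Bool Bool ℂ) β (b g.target)) *
        v (Function.update b g.target β)
    else v b := rfl

theorem inverse_act_act (g : QGate W) (v : QState W) : g.inverse.act (g.act v) = v := by
  ext b
  rw [act_apply]
  split_ifs with h
  · have h' : ∀ c ∈ g.controls, b c = true := h
    have hm : (star (g.mat : Matrix Bool Bool ℂ)) * (g.mat : Matrix Bool Bool ℂ) = 1 :=
      Matrix.mem_unitaryGroup_iff'.mp g.mat.2
    have key : ∀ β : Bool, g.act v (Function.update b g.target β) =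
        ∑ β' : Bool, (g.mat : Matrix Bool Bool ℂ) β β' * v (Function.update b g.target β') := by
      intro β
      rw [act_apply, if_pos ((controls_update_iff g b β).mpr h')]
      simp
    have e := fun i j => congrFun (congrFun hm i) j
    simp only [Matrix.mul_apply, Fintype.sum_bool, Matrix.one_apply] at e
    change ∑ β : Bool, (g.inverse.mat : Matrix Bool Bool ℂ) (b g.target) β *
      g.act v (Function.update b g.target β) = v b
    simp only [key, inverse_mat, Fintype.sum_bool]
    have hb : Function.update b g.target (b g.target) = b := Function.update_eq_self _ _
    cases hbt : b g.target <;> rw [hbt] at hb <;> rw [hb]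
    · have e1 := e false false; have e2 := e false true
      simp at e1 e2
      simp only [Matrix.star_apply, RCLike.star_def]
      linear_combination (v b) * e1 + v (Function.update b g.target true) * e2
    · have e1 := e true true; have e2 := e true false
      simp at e1 e2
      simp only [Matrix.star_apply, RCLike.star_def]
      linear_combination (v b) * e1 + v (Function.update b g.target false) * e2
  · rw [act_apply, if_neg]
    exact h

/-- The inverse gate is the adjoint. Together with `inverse_act_act` this gives preservation of the
norm. -/
theorem inner_inverse_act (g : QGate W) (v w : QState W) :
    inner ℂ (g.inverse.act v) w = inner ℂ v (g.act w) := by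
  simp only [PiLp.inner_apply, RCLike.inner_apply, inverse_act_apply]
  simp only [act_apply]
  rw [← Finset.sum_filter_add_sum_filter_not Finset.univ
      (fun b : W → Bool => ∀ c ∈ g.controls, b c = true)]
  conv_rhs => rw [← Finset.sum_filter_add_sum_filter_not Finset.univ
      (fun b : W → Bool => ∀ c ∈ g.controls, b c = true)]
  congr 1
  · have h1 : ∀ b ∈ Finset.univ.filter (fun b : W → Bool => ∀ c ∈ g.controls, b c = true),
        (w b) * (starRingEnd ℂ) (if ∀ c ∈ g.controls, b c = true then
          ∑ β : Bool, (starRingEnd ℂ) ((g.mat : Matrix Bool Bool ℂ) β (b g.target)) *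
            v (Function.update b g.target β) else v b) =
        ∑ β : Bool, (g.mat : Matrix Bool Bool ℂ) β (b g.target) * w b *
          (starRingEnd ℂ) (v (Function.update b g.target β)) := by
      intro b hb
      rw [if_pos (Finset.mem_filter.mp hb).2, map_sum, Finset.mul_sum]
      refine Finset.sum_congr rfl fun β _ => ?_
      rw [map_mul, Complex.conj_conj]
      ring
    have h2 : ∀ b ∈ Finset.univ.filter (fun b : W → Bool => ∀ c ∈ g.controls, b c = true),
        (if ∀ c ∈ g.controls, b c = true then
          ∑ β : Bool, (g.mat : Matrix Bool Bool ℂ) (b g.target) β *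
            w (Function.update b g.target β) else w b) * (starRingEnd ℂ) (v b) =
        ∑ β : Bool, (g.mat : Matrix Bool Bool ℂ) (b g.target) β *
          w (Function.update b g.target β) * (starRingEnd ℂ) (v b) := by
      intro b hb
      rw [if_pos (Finset.mem_filter.mp hb).2, Finset.sum_mul]
    rw [Finset.sum_congr rfl h1, Finset.sum_congr rfl h2, ← Finset.sum_product',
      ← Finset.sum_product']
    -- The involution exchanges the target bit of the assignment with the summation bit. It
    -- preserves the set of active controls because the target is not a control.
    refine Finset.sum_bij' (fun p _ => (Function.update p.1 g.target p.2, p.1 g.target))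
      (fun p _ => (Function.update p.1 g.target p.2, p.1 g.target)) ?_ ?_ ?_ ?_ ?_
    · intro p hp
      simp only [Finset.mem_product, Finset.mem_filter, Finset.mem_univ, true_and, and_true] at hp ⊢
      exact (controls_update_iff g _ _).mpr hp
    · intro p hp
      simp only [Finset.mem_product, Finset.mem_filter, Finset.mem_univ, true_and, and_true] at hp ⊢
      exact (controls_update_iff g _ _).mpr hp
    · intro p _; simp
    · intro p _; simp
    · intro p _; simp
  · refine Finset.sum_congr rfl fun b hb => ?_
    rw [if_neg (Finset.mem_filter.mp hb).2, if_neg (Finset.mem_filter.mp hb).2]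

theorem act_add (g : QGate W) (v w : QState W) : g.act (v + w) = g.act v + g.act w := by
  ext b
  simp only [act_apply, PiLp.add_apply, Fintype.sum_bool]
  split_ifs <;> ring

theorem act_smul (g : QGate W) (c : ℂ) (v : QState W) : g.act (c • v) = c • g.act v := by
  ext b
  simp only [act_apply, PiLp.smul_apply, smul_eq_mul, Fintype.sum_bool]
  split_ifs <;> ring

/-- A gate acts as a unitary operator, and its inverse gate as the inverse operator. -/
theorem exists_isometryEquiv (g : QGate W) :
    ∃ U : QState W ≃ₗᵢ[ℂ] QState W, (∀ v, U v = g.act v) ∧ ∀ v, U.symm v = g.inverse.act v := by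
  refine ⟨{ toFun := g.act, invFun := g.inverse.act, map_add' := g.act_add,
            map_smul' := g.act_smul, left_inv := g.inverse_act_act,
            right_inv := fun v => ?_, norm_map' := fun v => ?_ }, fun v => rfl, fun v => rfl⟩
  · have := g.inverse.inverse_act_act v
    rwa [inverse_inverse] at this
  · have h : inner ℂ (g.act v) (g.act v) = inner ℂ v v := by
      rw [← inner_inverse_act, inverse_act_act]
    rw [inner_self_eq_norm_sq_to_K, inner_self_eq_norm_sq_to_K] at h
    have h' : ‖g.act v‖ ^ 2 = ‖v‖ ^ 2 := by exact_mod_cast h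
    exact (sq_eq_sq₀ (norm_nonneg _) (norm_nonneg _)).mp h'

/-- Additional controls add to the number of controls, and a + b + 1 ≤ (a + 1)(b + 1). The
multiplicative form can be summed over a circuit; with the flag as the only new control the factor
is 2. -/
theorem cost_place_le {V : Type} (e : V ↪ W) (ctrl : Finset W)
    (h : ∀ i, e i ∉ ctrl) (g : QGate V) : (g.place e ctrl h).cost ≤ (ctrl.card + 1) * g.cost := by
  have h1 : (ctrl ∪ g.controls.map e).card ≤ ctrl.card + g.controls.card := by
    simpa using Finset.card_union_le ctrl (g.controls.map e)
  change (ctrl ∪ g.controls.map e).card + 1 ≤ (ctrl.card + 1) * (g.controls.card + 1)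
  nlinarith [Nat.zero_le (ctrl.card * g.controls.card)]

end QGate

namespace QCircuit

variable {W : Type}

theorem inverse_cons (g : QGate W) (P : QCircuit W) :
    QCircuit.inverse (g :: P) = QCircuit.inverse P ++ [g.inverse] := by
  simp [QCircuit.inverse]

theorem inverse_inverse [Fintype W] [DecidableEq W] (P : QCircuit W) : P.inverse.inverse = P := by
  simp only [QCircuit.inverse, List.map_reverse, List.reverse_reverse, List.map_map]
  conv_rhs => rw [← List.map_id P]
  exact List.map_congr_left fun g _ => g.inverse_inverse

theorem cost_inverse (P : QCircuit W) : P.inverse.cost = P.cost := by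
  simp only [QCircuit.inverse, QCircuit.cost, List.map_reverse, List.sum_reverse, List.map_map]
  rfl

theorem place_inverse {V : Type} [DecidableEq W] (e : V ↪ W) (ctrl : Finset W)
    (h : ∀ i, e i ∉ ctrl) (P : QCircuit V) :
    QCircuit.place e ctrl h P.inverse = QCircuit.inverse (QCircuit.place e ctrl h P) := by
  simp only [QCircuit.inverse, QCircuit.place, List.map_reverse, List.map_map]
  rfl

theorem cost_place_le {V : Type} [DecidableEq W] [Fintype W] (e : V ↪ W) (ctrl : Finset W)
    (h : ∀ i, e i ∉ ctrl) (P : QCircuit V) :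
    (QCircuit.place e ctrl h P).cost ≤ (ctrl.card + 1) * P.cost := by
  simp only [QCircuit.place, QCircuit.cost, List.map_map]
  rw [← List.sum_map_mul_left]
  exact List.sum_le_sum fun g _ => g.cost_place_le e ctrl h

variable [Fintype W] [DecidableEq W]

/-- A single isometric equivalence supplies linearity, preservation of norms and inner products, and
the role of the inverse circuit. -/
theorem exists_isometryEquiv (P : QCircuit W) :
    ∃ U : QState W ≃ₗᵢ[ℂ] QState W, (∀ v, U v = P.run v) ∧ ∀ v, U.symm v = P.inverse.run v := by
  induction P with
  | nil => exact ⟨LinearIsometryEquiv.refl ℂ _, fun v => rfl, fun v => rfl⟩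
  | cons g P ih =>
    obtain ⟨U, h1, h2⟩ := ih
    obtain ⟨G, h3, h4⟩ := g.exists_isometryEquiv
    refine ⟨G.trans U, fun v => ?_, fun v => ?_⟩
    · rw [LinearIsometryEquiv.trans_apply, h1, h3]; rfl
    · rw [LinearIsometryEquiv.symm_trans, LinearIsometryEquiv.trans_apply, h2, h4, inverse_cons]
      simp [QCircuit.run]

end QCircuit

/-! ### Instructions as unitary operators, and their inverses -/

namespace SwapTest

variable {n m a : ℕ}

namespace Instr

/-- The inverse instruction. -/
noncomputable def inverse : Instr n m a → Instr n m a
  | .gate g => .gate g.inverse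
  | .call which inv ctrl reg h => .call which (!inv) ctrl reg h
  | .eval dec => .eval dec

theorem cost_inverse (Px Py : QCircuit (Fin n)) (i : Instr n m a) :
    i.inverse.cost Px Py = i.cost Px Py := by
  cases i with
  | gate g => rfl
  | call which inv ctrl reg h =>
    cases inv <;> simp [inverse, cost, callCircuit, QCircuit.place_inverse, QCircuit.cost_inverse]
  | eval dec => rfl

end Instr

theorem evalBits_evalBits (f : ℝ → (Fin m → Bool)) (dec : (Fin a → Bool) → ℝ)
    (b : Wire n m a → Bool) : evalBits f dec (evalBits f dec b) = b := by
  funext w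
  cases w <;> simp [evalBits]

theorem Instr.exists_isometryEquiv (Px Py : QCircuit (Fin n)) (f : ℝ → (Fin m → Bool))
    (i : Instr n m a) :
    ∃ U : QState (Wire n m a) ≃ₗᵢ[ℂ] QState (Wire n m a),
      (∀ v, U v = i.act Px Py f v) ∧ ∀ v, U.symm v = i.inverse.act Px Py f v := by
  cases i with
  | gate g => exact g.exists_isometryEquiv
  | call which inv ctrl reg h =>
    obtain ⟨U, h1, h2⟩ := (callCircuit Px Py which inv ctrl reg h).exists_isometryEquiv
    refine ⟨U, h1, fun v => (h2 v).trans ?_⟩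
    have : (callCircuit Px Py which inv ctrl reg h).inverse =
        callCircuit Px Py which (!inv) ctrl reg h := by
      cases inv <;> simp [callCircuit, QCircuit.place_inverse, QCircuit.inverse_inverse]
    rw [this]; rfl
  | eval dec =>
    let e : Equiv.Perm (Wire n m a → Bool) :=
      ⟨evalBits f dec, evalBits f dec, evalBits_evalBits f dec, evalBits_evalBits f dec⟩
    refine ⟨LinearIsometryEquiv.piLpCongrLeft 2 ℂ ℂ e, fun v => ?_, fun v => ?_⟩
    · ext b; rfl
    · rw [LinearIsometryEquiv.piLpCongrLeft_symm]; ext b; rfl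

/-- Performing a list of instructions. -/
noncomputable def runList (Px Py : QCircuit (Fin n)) (f : ℝ → (Fin m → Bool))
    (L : List (Instr n m a)) (v : QState (Wire n m a)) : QState (Wire n m a) :=
  L.foldl (fun u i => i.act Px Py f u) v

/-- The instructions that undo a list of instructions. -/
noncomputable def inverseList (L : List (Instr n m a)) : List (Instr n m a) :=
  (L.map Instr.inverse).reverse

/-- The total time of a list of instructions. -/
noncomputable def listCost (Px Py : QCircuit (Fin n)) (L : List (Instr n m a)) : ℕ :=
  (L.map (Instr.cost Px Py)).sum

section

variable (Px Py : QCircuit (Fin n)) (f : ℝ → (Fin m → Bool))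

theorem runList_append (L L' : List (Instr n m a)) (v : QState (Wire n m a)) :
    runList Px Py f (L ++ L') v = runList Px Py f L' (runList Px Py f L v) := by
  simp [runList]

theorem runList_cons (i : Instr n m a) (L : List (Instr n m a)) (v : QState (Wire n m a)) :
    runList Px Py f (i :: L) v = runList Px Py f L (i.act Px Py f v) := rfl

theorem runList_nil (v : QState (Wire n m a)) : runList Px Py f [] v = v := rfl

theorem listCost_append (L L' : List (Instr n m a)) :
    listCost Px Py (L ++ L') = listCost Px Py L + listCost Px Py L' := by
  simp [listCost]

theorem listCost_cons (i : Instr n m a) (L : List (Instr n m a)) :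
    listCost Px Py (i :: L) = i.cost Px Py + listCost Px Py L := by
  simp [listCost]

theorem listCost_nil : listCost Px Py ([] : List (Instr n m a)) = 0 := rfl

theorem listCost_inverseList (L : List (Instr n m a)) :
    listCost Px Py (inverseList L) = listCost Px Py L := by
  simp only [inverseList, listCost, List.map_reverse, List.sum_reverse, List.map_map]
  congr 1
  exact List.map_congr_left fun i _ => i.cost_inverse Px Py

/-- A list of instructions acts as a unitary operator. -/
theorem exists_isometryEquiv (L : List (Instr n m a)) :
    ∃ U : QState (Wire n m a) ≃ₗᵢ[ℂ] QState (Wire n m a),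
      (∀ v, U v = runList Px Py f L v) ∧ ∀ v, U.symm v = runList Px Py f (inverseList L) v := by
  induction L with
  | nil => exact ⟨LinearIsometryEquiv.refl ℂ _, fun v => rfl, fun v => rfl⟩
  | cons i L ih =>
    obtain ⟨U, h1, h2⟩ := ih
    obtain ⟨G, h3, h4⟩ := i.exists_isometryEquiv Px Py f
    refine ⟨G.trans U, fun v => ?_, fun v => ?_⟩
    · rw [LinearIsometryEquiv.trans_apply, h1, h3]; rfl
    · rw [LinearIsometryEquiv.symm_trans, LinearIsometryEquiv.trans_apply, h2, h4]
      simp [inverseList, runList]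

end

end SwapTest

/-! ### Elementary matrices and the action of instructions on product vectors -/

/-- The NOT gate. -/
def notMatrix : Matrix.unitaryGroup Bool ℂ :=
  ⟨Matrix.of fun i j => if i = j then 0 else 1, by
    rw [Matrix.mem_unitaryGroup_iff]
    ext i j
    cases i <;> cases j <;> simp [Matrix.mul_apply]⟩

/-- The Hadamard gate. -/
noncomputable def hadamardMatrix : Matrix.unitaryGroup Bool ℂ :=
  ⟨Matrix.of fun i j => (1 / (Real.sqrt 2 : ℂ)) * if i = true ∧ j = true then -1 else 1, by
    have h : ((Real.sqrt 2 : ℝ) : ℂ) * (Real.sqrt 2 : ℝ) = 2 := by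
      exact_mod_cast Real.mul_self_sqrt (by norm_num : (0 : ℝ) ≤ 2)
    have h' : ((Real.sqrt 2 : ℝ) : ℂ)⁻¹ * ((Real.sqrt 2 : ℝ) : ℂ)⁻¹ = 1 / 2 := by
      rw [← mul_inv, h]; norm_num
    rw [Matrix.mem_unitaryGroup_iff]
    ext i j
    cases i <;> cases j <;> simp [Matrix.mul_apply, h']
    norm_num⟩

/-- The phase gate `diag(1, ω)`. -/
def phaseMatrix (ω : Circle) : Matrix.unitaryGroup Bool ℂ :=
  ⟨Matrix.diagonal fun i => if i = true then (ω : ℂ) else 1, by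
    rw [Matrix.mem_unitaryGroup_iff]
    ext i j
    have h : (ω : ℂ) * (starRingEnd ℂ) (ω : ℂ) = 1 := by
      rw [Complex.mul_conj, Complex.normSq_eq_norm_sq, Circle.norm_coe]; norm_num
    cases i <;> cases j <;> simp [Matrix.mul_apply, Matrix.diagonal, h]⟩

theorem notMatrix_apply (i j : Bool) :
    (notMatrix : Matrix Bool Bool ℂ) i j = if i = j then 0 else 1 := rfl

theorem hadamardMatrix_apply (i j : Bool) : (hadamardMatrix : Matrix Bool Bool ℂ) i j =
    (1 / (Real.sqrt 2 : ℂ)) * if i = true ∧ j = true then -1 else 1 := rfl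

theorem phaseMatrix_apply (ω : Circle) (i j : Bool) :
    (phaseMatrix ω : Matrix Bool Bool ℂ) i j =
      if i = j then (if i = true then (ω : ℂ) else 1) else 0 := rfl

namespace SwapTest

variable {n m a : ℕ}

/-- Vectors of the system that consists of the flag qubit and the data qubits. -/
abbrev Sys (n : ℕ) : Type := EuclideanSpace ℂ (Bool × (Fin n → Bool))

/-- Splitting an assignment of bits into flag and data, output, and ancilla bits. -/
def wireEquiv (n m a : ℕ) :
    (Wire n m a → Bool) ≃ (Bool × (Fin n → Bool)) × ((Fin m → Bool) × (Fin a → Bool)) where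
  toFun b := ((b .flag, fun i => b (.data i)), (fun j => b (.out j), fun k => b (.anc k)))
  invFun p
    | .flag => p.1.1
    | .data i => p.1.2 i
    | .out j => p.2.1 j
    | .anc k => p.2.2 k
  left_inv b := by funext w; cases w <;> rfl
  right_inv p := rfl

/-- The product of a vector of the system and a vector of the other qubits. -/
noncomputable def tens (ξ : Sys n) (χ : (Fin m → Bool) → (Fin a → Bool) → ℂ) :
    QState (Wire n m a) :=
  WithLp.toLp 2 fun b => ξ (b .flag, fun i => b (.data i)) *
    χ (fun j => b (.out j)) (fun k => b (.anc k))

theorem tens_apply (ξ : Sys n) (χ : (Fin m → Bool) → (Fin a → Bool) → ℂ) (b : Wire n m a → Bool) :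
    tens ξ χ b = ξ (b .flag, fun i => b (.data i)) *
      χ (fun j => b (.out j)) (fun k => b (.anc k)) := rfl

theorem sum_wire {M : Type*} [AddCommMonoid M] (F : (Wire n m a → Bool) → M) :
    ∑ b, F b = ∑ s, ∑ o, ∑ k, F ((wireEquiv n m a).symm (s, (o, k))) := by
  rw [← (wireEquiv n m a).symm.sum_comp, Fintype.sum_prod_type]
  refine Finset.sum_congr rfl fun s _ => ?_
  rw [Fintype.sum_prod_type]

theorem inner_tens (ξ ξ' : Sys n) (χ χ' : (Fin m → Bool) → (Fin a → Bool) → ℂ) :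
    inner ℂ (tens ξ χ) (tens ξ' χ') =
      inner ℂ ξ ξ' * ∑ o, ∑ k, χ' o k * (starRingEnd ℂ) (χ o k) := by
  simp only [PiLp.inner_apply, RCLike.inner_apply]
  rw [sum_wire, Finset.sum_mul]
  refine Finset.sum_congr rfl fun s _ => ?_
  rw [Finset.mul_sum]
  refine Finset.sum_congr rfl fun o _ => ?_
  rw [Finset.mul_sum]
  refine Finset.sum_congr rfl fun k _ => ?_
  simp only [tens_apply, map_mul]
  change ξ' s * χ' o k * ((starRingEnd ℂ) (ξ s) * (starRingEnd ℂ) (χ o k)) = _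
  ring

section gates

variable (Px Py : QCircuit (Fin n)) (f : ℝ → (Fin m → Bool))

/-- A one-qubit gate on the flag. -/
def flagGate (M : Matrix.unitaryGroup Bool ℂ) : Instr n m a :=
  .gate ⟨∅, .flag, by simp, M⟩

/-- The NOT gate on a data qubit. -/
def dataNot (i : Fin n) : Instr n m a :=
  .gate ⟨∅, .data i, by simp, notMatrix⟩

/-- The NOT gate on the flag, controlled by an ancilla. -/
def controlledNot (q : Fin a) : Instr n m a :=
  .gate ⟨{.anc q}, .flag, by simp, notMatrix⟩

/-- The sign change of `|1…1⟩` on flag and data, controlled by an ancilla. -/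
noncomputable def controlledSign (q : Fin a) : Instr n m a :=
  .gate ⟨insert (.anc q) (Finset.univ.image .data), .flag, by simp, phaseMatrix (-1)⟩

/-- A one-qubit gate on an ancilla, controlled by other ancillas. -/
def ancGate (C : Finset (Fin a)) (q : Fin a) (h : q ∉ C) (M : Matrix.unitaryGroup Bool ℂ) :
    Instr n m a :=
  .gate ⟨C.image .anc, .anc q, by simpa using h, M⟩

/-- The data qubits among all qubits. -/
def dataEmb (n m a : ℕ) : Fin n ↪ Wire n m a := ⟨.data, fun _ _ h => by simpa using h⟩

/-- A run of a preparation circuit on the data qubits, controlled by the flag. -/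
def flagCall (which : Bool) : Instr n m a :=
  .call which false {.flag} (dataEmb n m a) (by simp [dataEmb])

theorem flagGate_act (M : Matrix.unitaryGroup Bool ℂ) (ξ : Sys n)
    (χ : (Fin m → Bool) → (Fin a → Bool) → ℂ) :
    (flagGate M).act Px Py f (tens ξ χ) =
      tens (WithLp.toLp 2 fun s => ∑ β, (M : Matrix Bool Bool ℂ) s.1 β * ξ (β, s.2)) χ := by
  ext b
  simp only [flagGate, Instr.act, QGate.act_apply, tens_apply]
  rw [if_pos (by simp), Finset.sum_mul]
  refine Finset.sum_congr rfl fun β _ => ?_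
  simp [mul_assoc]

theorem dataNot_act (i : Fin n) (ξ : Sys n) (χ : (Fin m → Bool) → (Fin a → Bool) → ℂ) :
    (dataNot i).act Px Py f (tens ξ χ) =
      tens (WithLp.toLp 2 fun s => ξ (s.1, Function.update s.2 i (!s.2 i))) χ := by
  ext b
  simp only [dataNot, Instr.act, QGate.act_apply, tens_apply]
  rw [if_pos (by simp)]
  have h : ∀ β, (fun j => Function.update b (.data i) β (.data j)) =
      Function.update (fun j => b (.data j)) i β := by
    intro β
    funext j
    by_cases hj : j = i
    · subst hj; simp
    · simp [hj]
  simp only [Fintype.sum_bool, h, notMatrix_apply]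
  cases hb : b (.data i) <;> simp

theorem runList_dataNot (L : List (Fin n)) (hL : L.Nodup) (ξ : Sys n)
    (χ : (Fin m → Bool) → (Fin a → Bool) → ℂ) :
    runList Px Py f (L.map dataNot) (tens ξ χ) =
      tens (WithLp.toLp 2 fun s => ξ (s.1, fun i => if i ∈ L then !s.2 i else s.2 i)) χ := by
  induction L generalizing ξ with
  | nil => simp [runList_nil]
  | cons i L ih =>
    rw [List.map_cons, runList_cons, dataNot_act, ih (List.nodup_cons.mp hL).2]
    congr 1
    ext s
    simp only
    refine congrArg (fun d => ξ (s.1, d)) ?_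
    funext j
    by_cases hj : j = i
    · subst hj
      simp [(List.nodup_cons.mp hL).1]
    · simp [hj]

theorem controlledNot_act (q : Fin a) (ξ : Sys n) (χ : (Fin m → Bool) → (Fin a → Bool) → ℂ) :
    (controlledNot q).act Px Py f (tens ξ χ) =
      tens (WithLp.toLp 2 fun s => ξ (!s.1, s.2)) (fun o k => if k q = true then χ o k else 0) +
        tens ξ (fun o k => if k q = true then 0 else χ o k) := by
  ext b
  simp only [controlledNot, Instr.act, QGate.act_apply, tens_apply, PiLp.add_apply]
  by_cases hq : b (.anc q) = true
  · rw [if_pos (by simpa using hq)]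
    cases hb : b .flag <;> simp [hq, notMatrix_apply]
  · rw [if_neg (by simpa using hq)]
    simp [hq]

/-- The gate is 1 − 2|1…1⟩⟨1…1| on flag and data where the ancilla is 1. Here `w` is arbitrary,
since the gate will be conjugated by the preparation and so meets vectors that need not be products.
-/
theorem controlledSign_act (q : Fin a) (w : QState (Wire n m a)) :
    (controlledSign q).act Px Py f w = w - (2 : ℂ) •
      tens (EuclideanSpace.single (true, fun _ => true) 1)
        (fun o k => if k q = true then w ((wireEquiv n m a).symm ((true, fun _ => true), (o, k)))
          else 0) := by
  ext b
  simp only [controlledSign, Instr.act, QGate.act_apply, tens_apply, PiLp.sub_apply,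
    PiLp.smul_apply]
  by_cases h : ∀ i, b (.data i) = true
  · have hd : (fun i => b (.data i)) = fun _ => true := funext h
    by_cases hq : b (.anc q) = true
    swap
    · rw [if_neg (by simp [hq])]
      simp [hq]
    · rw [if_pos (by simp [hq, h])]
      simp only [Fintype.sum_bool, phaseMatrix_apply, hd]
      have hu : Function.update b .flag (b .flag) = b := Function.update_eq_self _ _
      cases hb : b .flag <;> rw [hb] at hu
      · simp [hu]
      · have hw : (wireEquiv n m a).symm ((true, fun _ => true),
            (fun j => b (.out j), fun k => b (.anc k))) = b := by
          rw [Equiv.symm_apply_eq]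
          exact Prod.ext (Prod.ext hb.symm hd.symm) rfl
        simp only [hw, hu, if_pos hq]
        simp
        ring
  · have hd : (fun i => b (.data i)) ≠ fun _ => true := fun e => h (congrFun e)
    rw [if_neg (by simpa using fun _ => h)]
    simp [hd]

theorem ancGate_act (C : Finset (Fin a)) (q : Fin a) (h : q ∉ C) (M : Matrix.unitaryGroup Bool ℂ)
    (ξ : Sys n) (χ : (Fin m → Bool) → (Fin a → Bool) → ℂ) :
    (ancGate C q h M).act Px Py f (tens ξ χ) =
      tens ξ fun o k => if ∀ c ∈ C, k c = true then
        ∑ β, (M : Matrix Bool Bool ℂ) (k q) β * χ o (Function.update k q β) else χ o k := by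
  ext b
  simp only [ancGate, Instr.act, QGate.act_apply, tens_apply]
  have h' : ∀ β, (fun j => Function.update b (.anc q) β (.anc j)) =
      Function.update (fun j => b (.anc j)) q β := by
    intro β
    funext j
    by_cases hj : j = q
    · subst hj; simp
    · simp [hj]
  simp only [h', Finset.forall_mem_image]
  split_ifs
  · rw [Finset.mul_sum]
    refine Finset.sum_congr rfl fun β _ => ?_
    simp
    ring
  · rfl

/-- The data qubits of a state, the other qubits being fixed. -/
noncomputable def restrictData (b : Wire n m a → Bool) (w : QState (Wire n m a)) :
    QState (Fin n) :=
  WithLp.toLp 2 fun d => w ((wireEquiv n m a).symm ((b .flag, d), (wireEquiv n m a b).2))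

/-- A circuit on the data, controlled by the flag, changes no bit outside the data. So each slice
with the other bits fixed evolves by itself: under `P` if the flag is 1, trivially otherwise. -/
theorem restrictData_place (b : Wire n m a → Bool) (h) (P : QCircuit (Fin n))
    (w : QState (Wire n m a)) :
    restrictData b ((QCircuit.place (dataEmb n m a) {.flag} h P).run w) =
      if b .flag = true then P.run (restrictData b w) else restrictData b w := by
  induction P generalizing w with
  | nil => simp [QCircuit.place, QCircuit.run]
  | cons g P ih =>
    have key : restrictData b ((g.place (dataEmb n m a) {.flag} h).act w) =
        if b .flag = true then g.act (restrictData b w) else restrictData b w := by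
      ext d
      have hc : (∀ c ∈ (g.place (dataEmb n m a) {.flag} h).controls,
          (wireEquiv n m a).symm ((b .flag, d), (wireEquiv n m a b).2) c = true) ↔
          b .flag = true ∧ ∀ c ∈ g.controls, d c = true := by
        simp only [QGate.place, dataEmb, wireEquiv, Finset.mem_union, Finset.mem_singleton,
          Finset.mem_map]
        constructor
        · intro H
          exact ⟨H _ (Or.inl rfl), fun c hc => H (.data c) (Or.inr ⟨c, hc, rfl⟩)⟩
        · rintro ⟨h1, h2⟩ c (rfl | ⟨i, hi, rfl⟩)
          exacts [h1, h2 i hi]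
      have hu : ∀ β, Function.update ((wireEquiv n m a).symm ((b .flag, d), (wireEquiv n m a b).2))
          (.data g.target) β = (wireEquiv n m a).symm
            ((b .flag, Function.update d g.target β), (wireEquiv n m a b).2) := by
        intro β
        funext c
        cases c with
        | data i =>
          by_cases hi : i = g.target
          · subst hi; simp [wireEquiv]
          · simp [wireEquiv, hi]
        | _ => simp [wireEquiv]
      change (g.place (dataEmb n m a) {.flag} h).act w _ = _
      rw [QGate.act_apply]
      simp only [hc]
      by_cases hb : b .flag = true
      · simp only [hb, true_and, if_true]
        rw [QGate.act_apply]
        by_cases hg : ∀ c ∈ g.controls, d c = true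
        swap
        · rw [if_neg hg, if_neg hg, restrictData, hb]
        rw [if_pos hg, if_pos hg]
        refine Finset.sum_congr rfl fun β _ => ?_
        have := hu β
        rw [hb] at this
        change _ * w (Function.update _ (.data g.target) β) = _
        rw [this, restrictData, hb]
        rfl
      · rw [if_neg (fun h => hb h.1), if_neg hb]
        rfl
    have := ih ((g.place (dataEmb n m a) {.flag} h).act w)
    rw [key] at this
    change restrictData b ((QCircuit.place (dataEmb n m a) {.flag} h P).run _) = _
    rw [this]
    split_ifs <;> rfl

theorem flagCall_act (which : Bool) (ξ : Sys n) (χ : (Fin m → Bool) → (Fin a → Bool) → ℂ) :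
    (flagCall which).act Px Py f (tens ξ χ) =
      tens (WithLp.toLp 2 fun s => if s.1 = true then
        (if which then Py else Px).run (WithLp.toLp 2 fun d => ξ (s.1, d)) s.2 else ξ s) χ := by
  ext b
  have h := congrArg (fun v : QState (Fin n) => v fun i => b (.data i))
    (restrictData_place b (by simp [dataEmb]) (if which then Py else Px) (tens ξ χ))
  have hb : (wireEquiv n m a).symm ((b .flag, fun i => b (.data i)), (wireEquiv n m a b).2) = b :=
    (wireEquiv n m a).symm_apply_apply b
  simp only [restrictData] at h
  rw [hb] at h
  change ((QCircuit.place (dataEmb n m a) {.flag} _ (if which then Py else Px)).run (tens ξ χ)) b = _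
  rw [h, tens_apply]
  simp only
  by_cases hf : b .flag = true
  · rw [if_pos hf, if_pos hf]
    -- A slice of a product vector is a scalar multiple of a slice of `ξ`, so linearity of the
    -- circuit pulls the other factor out.
    have hr : (WithLp.toLp 2 fun d => tens ξ χ ((wireEquiv n m a).symm
          ((b .flag, d), (wireEquiv n m a b).2)) : QState (Fin n)) =
        χ (fun j => b (.out j)) (fun k => b (.anc k)) •
          WithLp.toLp 2 fun d => ξ (b .flag, d) := by
      ext d
      exact mul_comm _ _
    obtain ⟨U, hU, -⟩ := (if which then Py else Px).exists_isometryEquiv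
    rw [hr, ← hU, ← hU, map_smul]
    exact mul_comm _ _
  · rw [if_neg hf, if_neg hf]
    exact congrArg (tens ξ χ) hb

/-! ### Preparation of the input vector and the controlled Grover operator -/

/-- The vector `(|0⟩|x⟩ + |1⟩|y⟩)/√2`. -/
noncomputable def pairVec (x y : QState (Fin n)) : Sys n :=
  WithLp.toLp 2 fun s => (1 / (Real.sqrt 2 : ℂ)) * if s.1 = true then y s.2 else x s.2

/-- The indicator function of a value of the output register and of vanishing ancillas. -/
def startFun (m a : ℕ) (z : Fin m → Bool) : (Fin m → Bool) → (Fin a → Bool) → ℂ :=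
  fun o k => if o = z ∧ k = fun _ => false then 1 else 0

theorem pairState_eq_tens (x y : QState (Fin n)) (z : Fin m → Bool) :
    (pairState x y z : QState (Wire n m a)) = tens (pairVec x y) (startFun m a z) := by
  ext b
  simp only [pairState, tens_apply, pairVec, startFun, mul_ite, mul_one, mul_zero, funext_iff]

/-- The instructions that map `|1…1⟩` to `(|0⟩|x⟩ + |1⟩|y⟩)/√2` on flag and data. -/
noncomputable def prepList (n m a : ℕ) : List (Instr n m a) :=
  (List.finRange n).map dataNot ++ [flagGate notMatrix, flagGate hadamardMatrix, flagCall true,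
    flagGate notMatrix, flagCall false, flagGate notMatrix]

/-- The NOT gates lead to |0⟩|0…0⟩, the Hadamard gate splits the flag, and the flag then selects
`Py`, or `Px` between two flips. The start is |1…1⟩ because controls react to the value 1: its sign
change is a single gate. -/
theorem runList_prepList (x y : QState (Fin n)) (hx : Px.Prepares x) (hy : Py.Prepares y)
    (χ : (Fin m → Bool) → (Fin a → Bool) → ℂ) :
    runList Px Py f (prepList n m a) (tens (EuclideanSpace.single (true, fun _ => true) 1) χ) =
      tens (pairVec x y) χ := by
  rw [prepList, runList_append, runList_dataNot _ _ _ _ (List.nodup_finRange n)]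
  simp only [runList_cons, runList_nil, flagGate_act, flagCall_act]
  congr 1
  have e : ∀ d : Fin n → Bool, (fun i => !d i) = (fun _ : Fin n => true) ↔
      d = fun _ => false := by
    intro d
    simp [funext_iff]
  have hs : ∀ c : ℂ, (WithLp.toLp 2 fun d => if d = (fun _ => false) then c else 0 :
      QState (Fin n)) = c • EuclideanSpace.single (fun _ => false) 1 := by
    intro c
    ext d
    simp
  have hr : ∀ (P : QCircuit (Fin n)) (z : QState (Fin n)) (c : ℂ), P.Prepares z →
      P.run (WithLp.toLp 2 fun d => if d = (fun _ => false) then c else 0) = c • z := by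
    intro P z c hP
    obtain ⟨U, hU, -⟩ := P.exists_isometryEquiv
    rw [hs, ← hU, map_smul, hU, hP]
  ext ⟨fl, d⟩
  cases fl <;> simp [notMatrix_apply, hadamardMatrix_apply, e,
    hr Px x _ hx, hr Py y _ hy, pairVec]

/-- The action of the NOT gate of the flag. -/
noncomputable def flipFlag (ξ : Sys n) : Sys n := WithLp.toLp 2 fun s => ξ (!s.1, s.2)

/-- The instructions for the controlled Grover operator. -/
noncomputable def groverList (q : Fin a) : List (Instr n m a) :=
  controlledNot q :: (inverseList (prepList n m a) ++ controlledSign q :: prepList n m a)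

/-- Conjugating the reflection in |1…1⟩ by the preparation gives the reflection in the prepared
vector. Only the sign change needs the control `q`: where the bit `q` is 0, the preparation and its
inverse cancel. -/
theorem runList_reflection (x y : QState (Fin n)) (hx : Px.Prepares x) (hy : Py.Prepares y)
    (q : Fin a) (w : QState (Wire n m a)) :
    runList Px Py f (inverseList (prepList n m a) ++ controlledSign q :: prepList n m a) w =
      w - (2 : ℂ) • tens (pairVec x y) (fun o k => if k q = true then
        inner ℂ (tens (pairVec x y) fun o' k' => if o' = o ∧ k' = k then 1 else 0) w else 0) := by
  obtain ⟨U, hU, hU'⟩ := exists_isometryEquiv Px Py f (prepList n m a)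
  rw [runList_append, runList_cons, controlledSign_act, ← hU', ← hU, map_sub, map_smul,
    LinearIsometryEquiv.apply_symm_apply, hU, runList_prepList Px Py f x y hx hy]
  congr 3
  funext o k
  refine if_congr Iff.rfl ?_ rfl
  -- The coefficient at |1…1⟩ after the inverse preparation is an inner product with a basis vector;
  -- unitarity moves the preparation onto that vector.
  rw [← runList_prepList Px Py f x y hx hy, ← hU, ← U.symm.inner_map_map,
    LinearIsometryEquiv.symm_apply_apply]
  have : (tens (EuclideanSpace.single (true, fun _ => true) 1) fun o' k' =>
      if o' = o ∧ k' = k then 1 else 0) = (EuclideanSpace.single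
        ((wireEquiv n m a).symm ((true, fun _ => true), (o, k))) 1 : QState (Wire n m a)) := by
    ext b
    simp only [tens_apply, PiLp.single_apply, Equiv.eq_symm_apply, Prod.ext_iff]
    simp only [wireEquiv, Equiv.coe_fn_mk]
    rw [ite_and]
    split_ifs <;> simp_all
  rw [this, EuclideanSpace.inner_single_left]
  simp

/-- Phase kickback: `hξ` says that `ξ` is an eigenvector of (1 − 2|ψ⟩⟨ψ|)X with eigenvalue `c`, so
the controlled operator only changes the ancilla factor of the product. -/
theorem runList_groverList (x y : QState (Fin n)) (hx : Px.Prepares x) (hy : Py.Prepares y)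
    (q : Fin a) (ξ : Sys n) (c : ℂ)
    (hξ : flipFlag ξ - (2 * inner ℂ (pairVec x y) (flipFlag ξ)) • pairVec x y = c • ξ)
    (χ : (Fin m → Bool) → (Fin a → Bool) → ℂ) :
    runList Px Py f (groverList q) (tens ξ χ) =
      tens ξ (fun o k => if k q = true then c * χ o k else χ o k) := by
  rw [groverList, runList_cons, controlledNot_act, runList_reflection Px Py f x y hx hy]
  change tens (flipFlag ξ) _ + _ - _ = _
  have e : ∀ o k, k q = true → inner ℂ
      (tens (pairVec x y) fun o' k' => if o' = o ∧ k' = k then 1 else 0 : QState (Wire n m a))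
      (tens (flipFlag ξ) (fun o k => if k q = true then χ o k else 0) +
        tens ξ (fun o k => if k q = true then 0 else χ o k)) =
      inner ℂ (pairVec x y) (flipFlag ξ) * χ o k := by
    intro o k hk
    rw [inner_add_right, inner_tens, inner_tens]
    have h1 : ∀ F : (Fin m → Bool) → (Fin a → Bool) → ℂ, ∑ o', ∑ k', F o' k' *
        (starRingEnd ℂ) (if o' = o ∧ k' = k then 1 else 0) = F o k := by
      intro F
      rw [Finset.sum_eq_single o, Finset.sum_eq_single k] <;> simp +contextual
    rw [h1, h1]
    simp [hk]
  change tens (flipFlag ξ) (fun o k => if k q = true then χ o k else 0) +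
    tens ξ (fun o k => if k q = true then 0 else χ o k) - (2 : ℂ) • _ = _
  ext b
  have hb := congrFun (congrArg WithLp.ofLp hξ) (b .flag, fun i => b (.data i))
  simp only [PiLp.sub_apply, PiLp.smul_apply, smul_eq_mul] at hb
  simp only [PiLp.add_apply, PiLp.sub_apply, PiLp.smul_apply, smul_eq_mul, tens_apply]
  by_cases hq : b (.anc q) = true
  · have e' := e (fun j => b (.out j)) (fun k => b (.anc k)) hq
    change (inner ℂ (tens (pairVec x y) _) (tens (flipFlag ξ) _ + tens ξ _)) = _ at e'
    simp only [hq, if_true]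
    erw [e']
    linear_combination (χ (fun j => b (.out j)) (fun k => b (.anc k))) * hb
  · simp [hq]

end gates

end SwapTest

/-! ### Phase estimation as a circuit -/

namespace SwapTest

variable {n m a : ℕ}

/-- One step of phase estimation on the ancilla `s`: a Hadamard gate, `p` controlled Grover
operators, phases `ω l` that depend on the earlier ancillas `l`, and a Hadamard gate. -/
noncomputable def estStep (n m : ℕ) (s : Fin a) (p : ℕ) (ω : ℕ → Circle) : List (Instr n m a) :=
  ancGate ∅ s (Finset.notMem_empty s) hadamardMatrix ::
    ((List.replicate p (groverList s)).flatten ++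
      ((List.finRange s).map (fun l => ancGate {Fin.castLE s.isLt.le l} s
        (by simp [Fin.ext_iff, l.isLt.ne']) (phaseMatrix (ω l))) ++
      [ancGate ∅ s (Finset.notMem_empty s) hadamardMatrix]))

/-- The amplitude of the bit of the ancilla `s` in phase estimation for the eigenvalue `c`. -/
noncomputable def estFactor (c : ℂ) (s : Fin a) (p : ℕ) (ω : ℕ → Circle) (k : Fin a → Bool) : ℂ :=
  (1 + (if k s = true then -1 else 1) * (c ^ p *
    ∏ l : Fin s, if k (Fin.castLE s.isLt.le l) = true then (ω l : ℂ) else 1)) / 2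

/-- The first `j` steps of phase estimation. -/
noncomputable def estList (n m : ℕ) (p : ℕ → ℕ) (ω : ℕ → ℕ → Circle) (j : ℕ) (hj : j ≤ a) :
    List (Instr n m a) :=
  (List.finRange j).flatMap fun s => estStep n m (Fin.castLE hj s) (p s) (ω s)

section

variable (Px Py : QCircuit (Fin n)) (f : ℝ → (Fin m → Bool))

theorem runList_replicate_groverList (x y : QState (Fin n)) (hx : Px.Prepares x)
    (hy : Py.Prepares y) (q : Fin a) (ξ : Sys n) (c : ℂ)
    (hξ : flipFlag ξ - (2 * inner ℂ (pairVec x y) (flipFlag ξ)) • pairVec x y = c • ξ) (p : ℕ)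
    (χ : (Fin m → Bool) → (Fin a → Bool) → ℂ) :
    runList Px Py f (List.replicate p (groverList q)).flatten (tens ξ χ) =
      tens ξ (fun o k => (if k q = true then c ^ p else 1) * χ o k) := by
  induction p generalizing χ with
  | zero => simp [runList_nil]
  | succ p ih =>
    rw [List.replicate_succ, List.flatten_cons, runList_append,
      runList_groverList Px Py f x y hx hy q ξ c hξ, ih]
    congr 1
    funext o k
    split_ifs <;> ring

theorem runList_phases (s : Fin a) (ω : ℕ → Circle) (L : List (Fin s)) (ξ : Sys n)
    (χ : (Fin m → Bool) → (Fin a → Bool) → ℂ) :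
    runList Px Py f (L.map (fun l => ancGate {Fin.castLE s.isLt.le l} s
        (by simp [Fin.ext_iff, l.isLt.ne']) (phaseMatrix (ω l)))) (tens ξ χ) =
      tens ξ (fun o k => (if k s = true then
        (L.map fun l => if k (Fin.castLE s.isLt.le l) = true then (ω l : ℂ) else 1).prod else 1) *
          χ o k) := by
  induction L generalizing χ with
  | nil => simp [runList_nil]
  | cons l L ih =>
    rw [List.map_cons, runList_cons, ancGate_act, ih]
    congr 1
    funext o k
    have hu : Function.update k s (k s) = k := Function.update_eq_self _ _
    simp only [Finset.mem_singleton, forall_eq, phaseMatrix_apply, Fintype.sum_bool,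
      List.map_cons, List.prod_cons]
    cases hs : k s <;> rw [hs] at hu <;> by_cases hl : k (Fin.castLE s.isLt.le l) = true
    · simp [hu]
    · simp [hl]
    · simp only [if_true, if_pos hl, hu]
      simp
      ring
    · simp [hl]

/-- The ancilla starts in |0⟩, as `hχ` says. The first Hadamard gate makes it an equal
superposition, the kickback and the phases multiply its |1⟩ part, and the second Hadamard gate forms
half the sum or half the difference. -/
theorem runList_estStep (x y : QState (Fin n)) (hx : Px.Prepares x)
    (hy : Py.Prepares y) (s : Fin a) (ξ : Sys n) (c : ℂ)
    (hξ : flipFlag ξ - (2 * inner ℂ (pairVec x y) (flipFlag ξ)) • pairVec x y = c • ξ) (p : ℕ)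
    (ω : ℕ → Circle) (χ : (Fin m → Bool) → (Fin a → Bool) → ℂ)
    (hχ : ∀ o k, k s = true → χ o k = 0) :
    runList Px Py f (estStep n m s p ω) (tens ξ χ) =
      tens ξ (fun o k => χ o (Function.update k s false) * estFactor c s p ω k) := by
  rw [estStep, runList_cons, runList_append, runList_append, runList_cons, runList_nil, ancGate_act,
    runList_replicate_groverList Px Py f x y hx hy s ξ c hξ, runList_phases, ancGate_act]
  congr 1
  funext o k
  have h2 : ((Real.sqrt 2 : ℝ) : ℂ)⁻¹ * ((Real.sqrt 2 : ℝ) : ℂ)⁻¹ = 1 / 2 := by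
    rw [← mul_inv]
    norm_cast
    rw [Real.mul_self_sqrt (by norm_num)]
    norm_num
  have hu : ∀ β (l : Fin s), Function.update k s β (Fin.castLE s.isLt.le l) =
      k (Fin.castLE s.isLt.le l) := by
    intro β l
    rw [Function.update_of_ne]
    simp [Fin.ext_iff, l.isLt.ne]
  have h0 : χ o (Function.update k s true) = 0 := hχ _ _ (by simp)
  simp only [Finset.notMem_empty, false_imp_iff, implies_true, if_true, Fintype.sum_bool,
    Function.update_self, Function.update_idem, h0, hadamardMatrix_apply, hu, estFactor,
    ← List.prod_ofFn, List.ofFn_eq_map]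
  cases hs : k s
  · simp
    linear_combination (χ o (Function.update k s false)) * (1 + c ^ p * (List.map (fun l : Fin s =>
      if k (Fin.castLE s.isLt.le l) = true then (ω l : ℂ) else 1) (List.finRange s)).prod) * h2
  · simp
    linear_combination (χ o (Function.update k s false)) * (1 - c ^ p * (List.map (fun l : Fin s =>
      if k (Fin.castLE s.isLt.le l) = true then (ω l : ℂ) else 1) (List.finRange s)).prod) * h2

theorem estFactor_congr (c : ℂ) (s : Fin a) (p : ℕ) (ω : ℕ → Circle) (k k' : Fin a → Bool)
    (h : ∀ l ≤ s, k l = k' l) : estFactor c s p ω k = estFactor c s p ω k' := by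
  have : ∀ l : Fin s, k (Fin.castLE s.isLt.le l) = k' (Fin.castLE s.isLt.le l) := fun l =>
    h _ (Fin.le_def.mpr l.isLt.le)
  simp only [estFactor, h s le_rfl, this]

/-- The measurement-free, semiclassical form of the inverse Fourier transform: each step writes one
fresh ancilla and only reads the earlier ones, so the amplitude of an ancilla content is a product
of one factor per bit. -/
theorem runList_estList (x y : QState (Fin n)) (hx : Px.Prepares x)
    (hy : Py.Prepares y) (ξ : Sys n) (c : ℂ)
    (hξ : flipFlag ξ - (2 * inner ℂ (pairVec x y) (flipFlag ξ)) • pairVec x y = c • ξ) (p : ℕ → ℕ)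
    (ω : ℕ → ℕ → Circle) (z : Fin m → Bool) (j : ℕ) (hj : j ≤ a) :
    runList Px Py f (estList n m p ω j hj) (tens ξ (startFun m a z)) =
      tens ξ (fun o k => if o = z ∧ ∀ s : Fin a, j ≤ s → k s = false then
        ∏ s : Fin j, estFactor c (Fin.castLE hj s) (p s) (ω s) k else 0) := by
  induction j with
  | zero =>
    simp only [estList, List.finRange_zero, List.flatMap_nil, runList_nil]
    congr 1
    funext o k
    simp [startFun, funext_iff]
  | succ j ih =>
    have e : estList n m p ω (j + 1) hj = estList n m p ω j (Nat.le_of_succ_le hj) ++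
        estStep n m (Fin.castLE hj (Fin.last j)) (p j) (ω j) := by
      simp only [estList, List.finRange_succ_last, List.flatMap_append, List.flatMap_map]
      simp
    rw [e, runList_append, ih, runList_estStep Px Py f x y hx hy _ ξ c hξ]
    · congr 1
      funext o k
      have hc : (∀ s : Fin a, j ≤ s →
          Function.update k (Fin.castLE hj (Fin.last j)) false s = false) ↔
          ∀ s : Fin a, j + 1 ≤ s → k s = false := by
        refine forall_congr' fun s => ?_
        by_cases hs : s = Fin.castLE hj (Fin.last j)
        · subst hs; simp
        · have : (s : ℕ) ≠ j := fun h => hs (Fin.ext h)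
          rw [Function.update_of_ne hs]
          have : j ≤ s ↔ j + 1 ≤ s := by omega
          rw [this]
      rw [ite_mul, zero_mul, Fin.prod_univ_castSucc]
      refine if_congr (and_congr Iff.rfl hc) (congrArg₂ _ (Finset.prod_congr rfl fun s _ => ?_) rfl) rfl
      refine estFactor_congr _ _ _ _ _ _ fun l hl => ?_
      rw [Function.update_of_ne]
      rintro rfl
      exact absurd s.isLt (not_lt.mpr (Fin.le_def.mp hl))
    · intro o k hk
      rw [if_neg]
      rintro ⟨-, h⟩
      rw [h _ (by simp)] at hk
      exact absurd hk (by simp)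

end

end SwapTest

/-! ### Tail bounds for the amplitudes of phase estimation -/

namespace SwapTest

/-- The amplitude of phase estimation with `t` bits, as a function of the quotient `w` of the
eigenvalue and the outcome. -/
noncomputable def estAmp (t : ℕ) (w : ℂ) : ℂ := ∏ j ∈ Finset.range t, (1 + w ^ 2 ^ j) / 2

/-- Telescoping with (1 − z)(1 + z) = 1 − z². The amplitude is the normalised geometric sum of the
first 2^t powers of `w`. -/
theorem estAmp_mul (t : ℕ) (w : ℂ) : estAmp t w * (2 ^ t * (1 - w)) = 1 - w ^ 2 ^ t := by
  induction t with
  | zero => simp [estAmp]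
  | succ t ih =>
    have : estAmp (t + 1) w = estAmp t w * ((1 + w ^ 2 ^ t) / 2) := Finset.prod_range_succ _ _
    rw [this, pow_succ 2 t, pow_succ 2 t, pow_mul]
    linear_combination (1 + w ^ 2 ^ t) * ih

theorem norm_estAmp_le_one (t : ℕ) (w : ℂ) (hw : ‖w‖ = 1) : ‖estAmp t w‖ ≤ 1 := by
  rw [estAmp, norm_prod]
  refine Finset.prod_le_one (fun _ _ => norm_nonneg _) fun j _ => ?_
  have h : ‖1 + w ^ 2 ^ j‖ ≤ 2 := (norm_add_le _ _).trans (by rw [norm_pow, hw]; norm_num)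
  rw [norm_div, Complex.norm_two]
  linarith

/-- With u = 2^t‖1 − w‖ the amplitude is at most 1 and at most 2/u. As (1 + u)² ≤ 2(1 + u²), the
constant is 2(1 + 4) = 10. -/
theorem norm_estAmp_sq_mul_le (t : ℕ) (w : ℂ) (hw : ‖w‖ = 1) :
    ‖estAmp t w‖ ^ 2 * (1 + 2 ^ t * ‖1 - w‖) ^ 2 ≤ 10 := by
  have h1 := norm_estAmp_le_one t w hw
  have h2 : ‖estAmp t w‖ * (2 ^ t * ‖1 - w‖) ≤ 2 := by
    have := congrArg norm (estAmp_mul t w)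
    rw [norm_mul, norm_mul, norm_pow, Complex.norm_two] at this
    rw [this]
    exact (norm_sub_le _ _).trans (by rw [norm_pow, hw]; norm_num)
  have h0 := norm_nonneg (estAmp t w)
  have h3 : 0 ≤ 2 ^ t * ‖1 - w‖ := by positivity
  set u := 2 ^ t * ‖1 - w‖
  have h4 : (‖estAmp t w‖ * u) ^ 2 ≤ 2 ^ 2 := pow_le_pow_left₀ (by positivity) h2 2
  have h5 : ‖estAmp t w‖ ^ 2 ≤ 1 ^ 2 := pow_le_pow_left₀ h0 h1 2
  nlinarith [mul_nonneg (sq_nonneg ‖estAmp t w‖) (sq_nonneg (1 - u))]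

/-- The weight `v ^ (-3/2)`. -/
noncomputable def weight (v : ℝ) : ℝ := 1 / (v * Real.sqrt v)

theorem weight_nonneg {v : ℝ} (hv : 0 ≤ v) : 0 ≤ weight v := by
  unfold weight; positivity

theorem weight_anti {v w : ℝ} (hv : 0 < v) (h : v ≤ w) : weight w ≤ weight v := by
  unfold weight
  have : 0 < Real.sqrt v := Real.sqrt_pos.mpr hv
  have : 0 < w := hv.trans_le h
  gcongr

theorem weight_half {v : ℝ} (hv : 0 < v) : weight (v / 2) ≤ 4 * weight v := by
  unfold weight
  have h1 : 0 < Real.sqrt v := Real.sqrt_pos.mpr hv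
  have h2 : Real.sqrt v / 2 ≤ Real.sqrt (v / 2) := by
    apply Real.le_sqrt_of_sq_le
    rw [div_pow, Real.sq_sqrt hv.le]
    linarith
  calc 1 / (v / 2 * Real.sqrt (v / 2)) ≤ 1 / (v / 2 * (Real.sqrt v / 2)) := by gcongr
    _ = 4 * (1 / (v * Real.sqrt v)) := by field_simp; norm_num

theorem norm_estAmp_sq_le (t : ℕ) (w : ℂ) (hw : ‖w‖ = 1) :
    ‖estAmp t w‖ ^ 2 ≤ 10 * weight (1 + 2 ^ t * ‖1 - w‖) := by
  have h := norm_estAmp_sq_mul_le t w hw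
  have hv : 1 ≤ 1 + 2 ^ t * ‖1 - w‖ := by
    have : 0 ≤ 2 ^ t * ‖1 - w‖ := by positivity
    linarith
  set v := 1 + 2 ^ t * ‖1 - w‖
  have hs : Real.sqrt v ≤ v := Real.sqrt_le_iff.mpr ⟨by linarith, by nlinarith⟩
  have hs0 : 0 < Real.sqrt v := Real.sqrt_pos.mpr (by linarith)
  rw [weight, mul_one_div, le_div_iff₀ (by positivity)]
  refine le_trans ?_ h
  rw [sq v]
  gcongr

/-- The square root of the error uses up half a power of the decay v^(-2), which leaves the summable
v^(-3/2) and gains 2^(-t/2). The error itself would leave v^(-1), which is not summable. -/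
theorem norm_estAmp_sq_mul_sqrt_le (t : ℕ) (w : ℂ) (hw : ‖w‖ = 1) :
    ‖estAmp t w‖ ^ 2 * Real.sqrt ‖1 - w‖ ≤
      10 * weight (1 + 2 ^ t * ‖1 - w‖) / Real.sqrt (2 ^ t) := by
  have h := norm_estAmp_sq_mul_le t w hw
  have hu : 0 ≤ 2 ^ t * ‖1 - w‖ := by positivity
  have hs : Real.sqrt ‖1 - w‖ * Real.sqrt (2 ^ t) ≤ Real.sqrt (1 + 2 ^ t * ‖1 - w‖) := by
    rw [← Real.sqrt_mul (norm_nonneg _)]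
    exact Real.sqrt_le_sqrt (by rw [mul_comm]; linarith)
  set v := 1 + 2 ^ t * ‖1 - w‖
  have hv : 0 < v := by linarith
  have hs0 : 0 < Real.sqrt v := Real.sqrt_pos.mpr hv
  have hN : 0 < Real.sqrt (2 ^ t : ℝ) := Real.sqrt_pos.mpr (by positivity)
  rw [weight, le_div_iff₀ hN, mul_one_div, le_div_iff₀ (by positivity)]
  calc ‖estAmp t w‖ ^ 2 * Real.sqrt ‖1 - w‖ * Real.sqrt (2 ^ t) * (v * Real.sqrt v)
      = ‖estAmp t w‖ ^ 2 * (Real.sqrt ‖1 - w‖ * Real.sqrt (2 ^ t)) * (v * Real.sqrt v) := by ring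
    _ ≤ ‖estAmp t w‖ ^ 2 * Real.sqrt v * (v * Real.sqrt v) := by gcongr
    _ = ‖estAmp t w‖ ^ 2 * v * (Real.sqrt v * Real.sqrt v) := by ring
    _ = ‖estAmp t w‖ ^ 2 * v ^ 2 := by rw [Real.mul_self_sqrt hv.le]; ring
    _ ≤ 10 := h

theorem summable_weight : Summable fun j : ℤ => weight (1 + |(j : ℝ)|) := by
  have h : Summable fun j : ℕ => weight (1 + (j : ℝ)) := by
    have h1 : Summable fun j : ℕ => 1 / ((j + 1 : ℕ) : ℝ) ^ (3 / 2 : ℝ) :=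
      (summable_nat_add_iff 1).mpr (Real.summable_one_div_nat_rpow.mpr (by norm_num))
    refine h1.congr fun j => ?_
    have hj : (0 : ℝ) < 1 + j := by positivity
    rw [weight, Nat.cast_add_one, add_comm (j : ℝ) 1]
    congr 1
    rw [show (3 / 2 : ℝ) = 1 + 1 / 2 by norm_num, Real.rpow_add hj, Real.rpow_one,
      Real.sqrt_eq_rpow]
  refine Summable.of_nat_of_neg ?_ ?_
  · simpa using h
  · simpa using h

/-- The value of the phase that is represented by `κ`. -/
noncomputable def phaseValue (t κ : ℕ) : ℂ := Complex.exp (2 * Real.pi * κ / 2 ^ t * Complex.I)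

theorem norm_phaseValue (t κ : ℕ) : ‖phaseValue t κ‖ = 1 := by
  have : phaseValue t κ = Complex.exp (((2 * Real.pi * κ / 2 ^ t : ℝ) : ℂ) * Complex.I) := by
    simp [phaseValue]
  rw [this, Complex.norm_exp_ofReal_mul_I]

/-- The chord is 2|sin| of half the angle, and |sin y| ≥ (2/π)|y| for |y| ≤ π/2. Since η lies in [0,
2π) and θ in [−π, π], half the difference can leave this range only upwards; subtracting one full
turn replaces κ by κ − 2^t. -/
theorem exists_int_norm_phaseValue_sub_ge (t κ : ℕ) (hκ : κ < 2 ^ t) (θ : ℝ) (hθ : |θ| ≤ Real.pi) :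
    ∃ κ' : ℤ, (κ' = κ ∨ κ' = κ - 2 ^ t) ∧ 4 * |(κ' : ℝ) - 2 ^ t * θ / (2 * Real.pi)| ≤
      2 ^ t * ‖phaseValue t κ - Complex.exp (θ * Complex.I)‖ := by
  have hpi := Real.pi_pos
  have hN : (0 : ℝ) < 2 ^ t := by positivity
  set η : ℝ := 2 * Real.pi * κ / 2 ^ t with hη
  have hη0 : 0 ≤ η := by positivity
  have hη1 : η < 2 * Real.pi := by
    rw [hη, div_lt_iff₀ hN]
    have : (κ : ℝ) < 2 ^ t := by exact_mod_cast hκ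
    nlinarith
  have hn : ‖phaseValue t κ - Complex.exp (θ * Complex.I)‖ = 2 * |Real.sin ((η - θ) / 2)| := by
    have e1 : phaseValue t κ - Complex.exp (θ * Complex.I) =
        Complex.exp (θ * Complex.I) * (Complex.exp (Complex.I * ((η - θ : ℝ) : ℂ)) - 1) := by
      rw [mul_sub, ← Complex.exp_add, mul_one, phaseValue]
      congr 2
      simp only [hη]
      push_cast
      ring
    rw [e1, norm_mul, Complex.norm_exp_ofReal_mul_I, one_mul, Complex.norm_exp_I_mul_ofReal_sub_one,
      Real.norm_eq_abs, abs_mul, abs_two]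
  have key : ∀ y : ℝ, |y| ≤ Real.pi / 2 → 4 * (2 ^ t * |y| / Real.pi) ≤
      2 ^ t * (2 * |Real.sin y|) := by
    intro y hy
    have := Real.mul_abs_le_abs_sin hy
    calc 4 * (2 ^ t * |y| / Real.pi) = 2 ^ t * (2 * (2 / Real.pi * |y|)) := by ring
      _ ≤ _ := by gcongr
  rw [hn]
  have hθ' := abs_le.mp hθ
  rcases le_total ((η - θ) / 2) (Real.pi / 2) with h | h
  · refine ⟨κ, Or.inl rfl, ?_⟩
    have := key ((η - θ) / 2) (abs_le.mpr ⟨by linarith, h⟩)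
    convert this using 2
    rw [← abs_of_pos hN, ← abs_mul, abs_of_pos hN, ← abs_of_pos hpi, ← abs_div, abs_of_pos hpi]
    congr 1
    simp only [hη, Int.cast_natCast]
    field_simp
  · refine ⟨κ - 2 ^ t, Or.inr rfl, ?_⟩
    have := key ((η - θ) / 2 - Real.pi) (abs_le.mpr ⟨by linarith, by linarith⟩)
    rw [Real.sin_sub_pi, abs_neg] at this
    convert this using 2
    rw [← abs_of_pos hN, ← abs_mul, abs_of_pos hN, ← abs_of_pos hpi, ← abs_div, abs_of_pos hpi]
    congr 1
    simp only [hη]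
    push_cast
    field_simp
    ring

/-- The constant in the tail estimates of phase estimation. -/
noncomputable def tailConst : ℝ := 8 * ∑' j : ℤ, weight (1 + |(j : ℝ)|)

theorem tailConst_nonneg : 0 ≤ tailConst :=
  mul_nonneg (by norm_num) (tsum_nonneg fun _ => weight_nonneg (by positivity))

/-- Up to one full turn, the outcomes are consecutive integers around 2^t · arg(c)/(2π), so the sum
is dominated by two shifted copies of a convergent series over ℤ. Halving the argument of `weight`
absorbs the rounding of the centre to an integer at the price of a factor 4; hence the 8 in
`tailConst`. -/
theorem sum_weight_le (t : ℕ) (c : ℂ) (hc : ‖c‖ = 1) :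
    ∑ κ ∈ Finset.range (2 ^ t), weight (1 + 2 ^ t * ‖phaseValue t κ - c‖) ≤ tailConst := by
  have hcθ : c = Complex.exp (c.arg * Complex.I) := by
    have := Complex.norm_mul_exp_arg_mul_I c
    rw [hc] at this
    simpa using this.symm
  set A : ℤ := ⌊2 ^ t * c.arg / (2 * Real.pi)⌋ with hA
  have hpt : ∀ κ ∈ Finset.range (2 ^ t), weight (1 + 2 ^ t * ‖phaseValue t κ - c‖) ≤
      4 * weight (1 + |((κ - A : ℤ) : ℝ)|) + 4 * weight (1 + |((κ - 2 ^ t - A : ℤ) : ℝ)|) := by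
    intro κ hκ
    obtain ⟨κ', hκ', h⟩ := exists_int_norm_phaseValue_sub_ge t κ (Finset.mem_range.mp hκ) c.arg
      (Complex.abs_arg_le_pi c)
    rw [← hcθ] at h
    have hu : 0 ≤ 2 ^ t * ‖phaseValue t κ - c‖ := by positivity
    have h1 : |((κ' - A : ℤ) : ℝ)| ≤ |(κ' : ℝ) - 2 ^ t * c.arg / (2 * Real.pi)| + 1 := by
      have h2 := Int.floor_le (2 ^ t * c.arg / (2 * Real.pi))
      have h3 := Int.lt_floor_add_one (2 ^ t * c.arg / (2 * Real.pi))
      rw [← hA] at h2 h3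
      push_cast
      rw [abs_le]
      constructor
      · linarith [neg_abs_le ((κ' : ℝ) - 2 ^ t * c.arg / (2 * Real.pi))]
      · linarith [le_abs_self ((κ' : ℝ) - 2 ^ t * c.arg / (2 * Real.pi))]
    have h4 : weight (1 + 2 ^ t * ‖phaseValue t κ - c‖) ≤
        4 * weight (1 + |((κ' - A : ℤ) : ℝ)|) := by
      refine le_trans (weight_anti (by positivity) ?_) (weight_half (by positivity))
      have := abs_nonneg ((κ' : ℝ) - 2 ^ t * c.arg / (2 * Real.pi))
      linarith
    have h5 : ∀ j : ℤ, 0 ≤ 4 * weight (1 + |(j : ℝ)|) := fun j =>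
      mul_nonneg (by norm_num) (weight_nonneg (by positivity))
    rcases hκ' with rfl | rfl
    · linarith [h5 (κ - 2 ^ t - A)]
    · linarith [h5 (κ - A)]
  have hshift : ∀ B : ℤ, ∑ κ ∈ Finset.range (2 ^ t), weight (1 + |((κ - B : ℤ) : ℝ)|) ≤
      ∑' j : ℤ, weight (1 + |(j : ℝ)|) := by
    intro B
    have hinj : Function.Injective fun κ : ℕ => (κ : ℤ) - B := fun κ κ' h => by
      simpa using h
    have h := Finset.sum_map (Finset.range (2 ^ t)) ⟨_, hinj⟩
      (fun j : ℤ => weight (1 + |(j : ℝ)|))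
    simp only [Function.Embedding.coeFn_mk] at h
    rw [← h]
    exact summable_weight.sum_le_tsum _ fun _ _ => weight_nonneg (by positivity)
  refine (Finset.sum_le_sum hpt).trans ?_
  rw [Finset.sum_add_distrib, ← Finset.mul_sum, ← Finset.mul_sum, tailConst]
  have h1 := hshift A
  have h2 := hshift (2 ^ t + A)
  simp only [← sub_sub] at h2
  linarith

/-! ### The median of three and rounding to a randomly shifted grid -/

/-- The median of three real numbers. -/
noncomputable def median (u v w : ℝ) : ℝ := max (min u v) (min (max u v) w)

/-- The distance of the median from `c` is bounded by the distances of at least two of the three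
numbers, hence by their geometric mean. The sum covers all three possible pairs. -/
theorem abs_median_sub_le (u v w c : ℝ) : |median u v w - c| ≤
    Real.sqrt |u - c| * Real.sqrt |v - c| + Real.sqrt |u - c| * Real.sqrt |w - c| +
      Real.sqrt |v - c| * Real.sqrt |w - c| := by
  have key : ∀ p q z : ℝ, |z| ≤ |p| → |z| ≤ |q| → |z| ≤ Real.sqrt |p| * Real.sqrt |q| := by
    intro p q z hp hq
    rw [← Real.sqrt_mul (abs_nonneg _)]
    refine Real.le_sqrt_of_sq_le ?_
    rw [sq]
    exact mul_le_mul hp hq (abs_nonneg _) (abs_nonneg _)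
  have h1 : 0 ≤ Real.sqrt |u - c| * Real.sqrt |v - c| := by positivity
  have h2 : 0 ≤ Real.sqrt |u - c| * Real.sqrt |w - c| := by positivity
  have h3 : 0 ≤ Real.sqrt |v - c| * Real.sqrt |w - c| := by positivity
  have h : (|median u v w - c| ≤ |u - c| ∧ |median u v w - c| ≤ |v - c|) ∨
      (|median u v w - c| ≤ |u - c| ∧ |median u v w - c| ≤ |w - c|) ∨
      (|median u v w - c| ≤ |v - c| ∧ |median u v w - c| ≤ |w - c|) := by
    unfold median
    grind
  rcases h with ⟨a, b⟩ | ⟨a, b⟩ | ⟨a, b⟩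
  · linarith [key _ _ _ a b]
  · linarith [key _ _ _ a b]
  · linarith [key _ _ _ a b]

/-- Rounding to a grid of width `ε`, shifted by `j / M` of the width. -/
noncomputable def gridRound (M : ℕ) (ε : ℝ) (j : ℕ) (v : ℝ) : ℝ :=
  ε * ((((⌊M * v / ε⌋ + j) / M : ℤ) : ℝ) - j / M)

theorem abs_sub_gridRound_le (M : ℕ) (hM : 0 < M) (ε : ℝ) (hε : 0 < ε) (j : ℕ) (v : ℝ) :
    |v - gridRound M ε j v| ≤ ε := by
  have hM' : (0 : ℝ) < M := by exact_mod_cast hM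
  have h1 := Int.floor_le (M * v / ε)
  have h2 := Int.lt_floor_add_one (M * v / ε)
  have h3 := Int.emod_add_mul_ediv (⌊M * v / ε⌋ + j) M
  have h4 := Int.emod_nonneg (⌊M * v / ε⌋ + j) (by positivity : (M : ℤ) ≠ 0)
  have h5 := Int.emod_lt_of_pos (⌊M * v / ε⌋ + j) (by positivity : (0 : ℤ) < M)
  unfold gridRound
  generalize (⌊M * v / ε⌋ + j) % (M : ℤ) = r at *
  generalize (⌊M * v / ε⌋ + j) / (M : ℤ) = q at *
  generalize ⌊M * v / ε⌋ = A at *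
  have h3' : (r : ℝ) + M * q = A + j := by exact_mod_cast h3
  have h4' : (0 : ℝ) ≤ r := by exact_mod_cast h4
  have h5' : (r : ℝ) + 1 ≤ M := by exact_mod_cast h5
  -- The error is ε/M times a fractional part in [0, 1) plus a remainder of at most M − 1.
  have e : v - ε * (q - j / M) = ε * ((M * v / ε - A + r) / M) := by
    field_simp
    linear_combination -ε * h3'
  rw [e, abs_mul, abs_of_pos hε]
  refine mul_le_of_le_one_right hε.le ?_
  rw [abs_le]
  constructor
  · exact le_trans (by norm_num) (div_nonneg (by linarith) hM'.le)
  · rw [div_le_one hM']; linarith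

/-- Summed over a full period of `j`, the quotients grow by exactly 1 when A grows by 1. Hence the
total increase is d, and every `j` whose quotient changes uses at least 1 of it. -/
theorem card_ediv_ne_le (M : ℕ) (hM : 0 < M) (A : ℤ) (d : ℕ) :
    ((Finset.range M).filter fun j : ℕ => (A + j) / (M : ℤ) ≠ (A + d + j) / (M : ℤ)).card ≤ d := by
  have hM' : (0 : ℤ) < M := by exact_mod_cast hM
  have hsum : ∀ d : ℕ, ∑ j ∈ Finset.range M, (A + d + j) / (M : ℤ) =
      ∑ j ∈ Finset.range M, (A + j) / (M : ℤ) + d := by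
    intro d
    induction d with
    | zero => simp
    | succ d ih =>
      have h := Finset.sum_range_sub (fun j : ℕ => (A + d + j) / (M : ℤ)) M
      rw [Int.add_ediv_of_dvd_right (dvd_refl _), Int.ediv_self hM'.ne', Finset.sum_sub_distrib,
        ih] at h
      simp only [Nat.cast_add, Nat.cast_one, Nat.cast_zero, add_zero] at h ⊢
      have e : ∀ j : ℕ, A + (d + 1 : ℤ) + j = A + d + (j + 1 : ℤ) := fun j => by ring
      simp only [e]
      linarith
  have h : ((((Finset.range M).filter fun j : ℕ =>
      (A + j) / (M : ℤ) ≠ (A + d + j) / (M : ℤ)).card : ℕ) : ℤ) ≤ d := by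
    rw [Finset.card_filter]
    push_cast
    have : ∀ j ∈ Finset.range M, (if (A + j) / (M : ℤ) ≠ (A + d + j) / (M : ℤ) then (1 : ℤ) else 0) ≤
        (A + d + j) / (M : ℤ) - (A + j) / (M : ℤ) := by
      intro j _
      have hle : (A + j) / (M : ℤ) ≤ (A + d + j) / (M : ℤ) :=
        Int.ediv_le_ediv hM' (by linarith [Int.natCast_nonneg d])
      split_ifs with hne
      · omega
      · linarith
    refine (Finset.sum_le_sum this).trans ?_
    rw [Finset.sum_sub_distrib, hsum]
    linarith
  exact_mod_cast h

/-- Only the difference of the two floors matters; the summand 1 pays for taking floors. -/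
theorem card_gridRound_ne_le (M : ℕ) (hM : 0 < M) (ε : ℝ) (hε : 0 < ε) (v w : ℝ) :
    (((Finset.range M).filter fun j => gridRound M ε j v ≠ gridRound M ε j w).card : ℝ) ≤
      M * |v - w| / ε + 1 := by
  wlog h : v ≤ w generalizing v w
  · have := this w v (le_of_not_ge h)
    simp only [ne_comm, abs_sub_comm] at this ⊢
    exact this
  have hM' : (0 : ℝ) < M := by exact_mod_cast hM
  have hfl : ⌊M * v / ε⌋ ≤ ⌊M * w / ε⌋ := Int.floor_le_floor (by gcongr)
  obtain ⟨d, hd⟩ := Int.eq_ofNat_of_zero_le (sub_nonneg.mpr hfl)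
  have hd' : ⌊M * w / ε⌋ = ⌊M * v / ε⌋ + d := by omega
  have h1 : ((Finset.range M).filter fun j => gridRound M ε j v ≠ gridRound M ε j w).card ≤ d := by
    refine le_trans (Finset.card_le_card ?_) (card_ediv_ne_le M hM ⌊M * v / ε⌋ d)
    refine Finset.monotone_filter_right _ fun j _ hj h => hj ?_
    rw [gridRound, gridRound, hd', h]
  have h2 : (d : ℝ) ≤ M * |v - w| / ε + 1 := by
    have h3 := Int.floor_le (M * w / ε)
    have h4 := Int.lt_floor_add_one (M * v / ε)
    have h5 : ((⌊M * w / ε⌋ : ℤ) : ℝ) = ⌊M * v / ε⌋ + d := by rw [hd']; push_cast; rfl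
    rw [abs_sub_comm, abs_of_nonneg (sub_nonneg.mpr h)]
    have e : M * (w - v) / ε = M * w / ε - M * v / ε := by ring
    rw [e]
    linarith
  exact le_trans (by exact_mod_cast h1) h2

end SwapTest

/-! ### Three rounds of phase estimation and the mean error of the estimate -/

namespace SwapTest

variable {a : ℕ}

/-- The `l`-th bit of an ancilla content. -/
def bitAt (k : Fin a → Bool) (l : ℕ) : Bool := if h : l < a then k ⟨l, h⟩ else false

/-- The number whose binary digits are the bits of the `r`-th block of `t` ancillas. -/
def outcome (t : ℕ) (k : Fin a → Bool) (r : ℕ) : ℕ :=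
  ∑ l ∈ Finset.range t with bitAt k (t * r + l) = true, 2 ^ l

/-- The power of the Grover operator in the `s`-th step. -/
def stepPower (t s : ℕ) : ℕ := 2 ^ (t - 1 - s % t)

/-- The phases of the `s`-th step. -/
noncomputable def stepPhase (t s l : ℕ) : Circle :=
  if l / t = s / t then Circle.exp (-(Real.pi / 2 ^ (s % t - l % t))) else 1

/-- In this power of the inverse phase, bit l contributes the angle −π · 2^(l−i): whole turns for l
> i, the sign for l = i, and the applied phase gates for l < i. -/
theorem prod_phase_eq (t i : ℕ) (hi : i < t) (b : ℕ → Bool) :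
    (if b i = true then -1 else 1) * ∏ l ∈ Finset.range i,
      (if b l = true then (Circle.exp (-(Real.pi / 2 ^ (i - l))) : ℂ) else 1) =
    ((phaseValue t (∑ l ∈ Finset.range t with b l = true, 2 ^ l))⁻¹) ^ 2 ^ (t - 1 - i) := by
  obtain ⟨d, rfl⟩ : ∃ d, t = i + 1 + d := ⟨t - (i + 1), by omega⟩
  have e1 : ((phaseValue (i + 1 + d)
      (∑ l ∈ Finset.range (i + 1 + d) with b l = true, 2 ^ l))⁻¹) ^ 2 ^ (i + 1 + d - 1 - i) =
      Complex.exp (∑ l ∈ Finset.range (i + 1 + d),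
        if b l = true then -(Real.pi * 2 ^ l / 2 ^ i) * Complex.I else 0) := by
    rw [phaseValue, ← Complex.exp_neg, ← Complex.exp_nat_mul]
    congr 1
    have : i + 1 + d - 1 - i = d := by omega
    rw [this, Finset.sum_filter]
    push_cast
    have h2 : ∀ l, (if b l = true then -(Real.pi * 2 ^ l / 2 ^ i) * Complex.I else 0) =
        -(Real.pi / 2 ^ i) * Complex.I * (if b l = true then 2 ^ l else 0) := by
      intro l; split_ifs <;> ring
    simp only [h2]
    rw [← Finset.mul_sum, pow_add, pow_add]
    generalize (∑ l ∈ Finset.range (i + 1 + d), if b l = true then (2 : ℂ) ^ l else 0) = S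
    field_simp
  rw [e1, Complex.exp_sum, Finset.prod_range_add, Finset.prod_range_succ, mul_comm]
  have e2 : ∏ x ∈ Finset.range d, Complex.exp (if b (i + 1 + x) = true then
      -(Real.pi * 2 ^ (i + 1 + x) / 2 ^ i) * Complex.I else 0) = 1 := by
    refine Finset.prod_eq_one fun x _ => ?_
    split_ifs
    · rw [Complex.exp_eq_one_iff]
      refine ⟨-(2 ^ x), ?_⟩
      push_cast
      rw [pow_add, pow_add]
      field_simp
    · exact Complex.exp_zero
  rw [e2, mul_one]
  congr 1
  · refine Finset.prod_congr rfl fun l hl => ?_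
    split_ifs
    · rw [Circle.coe_exp]
      congr 1
      have hl' : i = l + (i - l) := by have := Finset.mem_range.mp hl; omega
      have hp : (2 : ℂ) ^ i = 2 ^ l * 2 ^ (i - l) := by rw [← pow_add, ← hl']
      rw [hp]
      push_cast
      field_simp
    · exact Complex.exp_zero.symm
  · split_ifs
    · rw [mul_div_assoc, div_self (pow_ne_zero _ two_ne_zero), mul_one, neg_mul, Complex.exp_neg,
        Complex.exp_pi_mul_I]
      norm_num
    · exact Complex.exp_zero.symm

/-- `stepPhase` is 1 on the bits of earlier blocks, so each round is unaffected by the outcomes of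
the others. -/
theorem estFactor_eq (c : ℂ) (t r i : ℕ) (hi : i < t) (s : Fin a) (hs : (s : ℕ) = t * r + i)
    (k : Fin a → Bool) :
    estFactor c s (stepPower t s) (stepPhase t s) k =
      (1 + (c * (phaseValue t (outcome t k r))⁻¹) ^ 2 ^ (t - 1 - i)) / 2 := by
  have ht : 0 < t := by omega
  have hmod : ∀ l < t, (t * r + l) % t = l := fun l hl => by
    rw [Nat.mul_add_mod, Nat.mod_eq_of_lt hl]
  have hdiv : ∀ l < t, (t * r + l) / t = r := fun l hl => by
    rw [Nat.mul_add_div ht, Nat.div_eq_of_lt hl, add_zero]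
  have hb : ∀ l (hl : l < a), bitAt k l = k ⟨l, hl⟩ := fun l hl => by simp [bitAt, hl]
  have e1 : (∏ l : Fin s, if k (Fin.castLE s.isLt.le l) = true then
      (stepPhase t s l : ℂ) else 1) = ∏ l ∈ Finset.range i, (if bitAt k (t * r + l) = true then
        (Circle.exp (-(Real.pi / 2 ^ (i - l))) : ℂ) else 1) := by
    have : ∀ l : Fin s, (if k (Fin.castLE s.isLt.le l) = true then (stepPhase t s l : ℂ) else 1) =
        (fun l : ℕ => if bitAt k l = true then (stepPhase t s l : ℂ) else 1) l := by
      intro l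
      simp only [hb l (l.isLt.trans s.isLt)]
      rfl
    rw [Finset.prod_congr rfl fun l _ => this l,
      ← Finset.prod_range (fun l : ℕ => if bitAt k l = true then (stepPhase t s l : ℂ) else 1),
      hs, Finset.prod_range_add]
    rw [Finset.prod_eq_one, one_mul]
    · refine Finset.prod_congr rfl fun l hl => ?_
      have hl' : l < i := Finset.mem_range.mp hl
      simp only [stepPhase, hdiv l (hl'.trans hi), hdiv i hi, hmod l (hl'.trans hi), hmod i hi,
        if_true]
    · intro l hl
      have : l / t ≠ (t * r + i) / t := by
        rw [hdiv i hi]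
        exact ((Nat.div_lt_iff_lt_mul ht).mpr (by
          rw [mul_comm]; exact Finset.mem_range.mp hl)).ne
      simp [stepPhase, this]
  have e2 : k s = bitAt k (t * r + i) := by
    rw [hb _ (hs ▸ s.isLt)]; congr 1; exact Fin.ext hs
  rw [estFactor, e1, e2, mul_pow, outcome, ← prod_phase_eq t i hi fun l => bitAt k (t * r + l)]
  simp only [stepPower, hs, hmod i hi]
  ring

theorem prod_estFactor_eq (c : ℂ) (t : ℕ) (k : Fin (3 * t) → Bool) :
    ∏ s : Fin (3 * t), estFactor c s (stepPower t s) (stepPhase t s) k =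
      ∏ r : Fin 3, estAmp t (c * (phaseValue t (outcome t k r))⁻¹) := by
  rw [← finProdFinEquiv.prod_comp, Fintype.prod_prod_type]
  refine Finset.prod_congr rfl fun r _ => ?_
  have : ∀ i : Fin t, estFactor c (finProdFinEquiv (r, i)) (stepPower t (finProdFinEquiv (r, i)))
      (stepPhase t (finProdFinEquiv (r, i))) k = (fun i : ℕ =>
        (1 + (c * (phaseValue t (outcome t k r))⁻¹) ^ 2 ^ (t - 1 - i)) / 2) i := fun i =>
    estFactor_eq c t r i i.isLt _ (by simp [finProdFinEquiv, add_comm]) k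
  rw [Finset.prod_congr rfl fun i _ => this i, ← Finset.prod_range (fun i : ℕ =>
        (1 + (c * (phaseValue t (outcome t k r))⁻¹) ^ 2 ^ (t - 1 - i)) / 2)]
  exact Finset.prod_range_reflect
    (fun j => (1 + (c * (phaseValue t (outcome t k r))⁻¹) ^ 2 ^ j) / 2) t

theorem outcome_lt (t : ℕ) (k : Fin a → Bool) (r : ℕ) : outcome t k r < 2 ^ t :=
  Nat.geomSum_lt le_rfl fun _ hl => Finset.mem_range.mp (Finset.mem_filter.mp hl).1

theorem outcome_injective (t : ℕ) (k k' : Fin (3 * t) → Bool)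
    (h : ∀ r < 3, outcome t k r = outcome t k' r) : k = k' := by
  funext s
  have ht : 0 < t := by have := s.isLt; omega
  have hr : (s : ℕ) / t < 3 := (Nat.div_lt_iff_lt_mul ht).mpr s.isLt
  have hset := Finset.geomSum_injective le_rfl (h _ hr)
  have hm := Finset.ext_iff.mp hset (s % t)
  simp only [Finset.mem_filter, Finset.mem_range, Nat.mod_lt _ ht, true_and, Nat.div_add_mod] at hm
  have hb : ∀ k : Fin (3 * t) → Bool, bitAt k s = k s := fun k => by simp [bitAt]
  rw [hb, hb] at hm
  exact Bool.eq_iff_iff.mpr hm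

/-- An ancilla content is determined by its three outcomes, so the sum embeds into the expanded
product. Nonnegativity makes surjectivity unnecessary. -/
theorem sum_outcome_le (t : ℕ) (p q s : ℕ → ℝ) (hp : ∀ κ, 0 ≤ p κ) (hq : ∀ κ, 0 ≤ q κ)
    (hs : ∀ κ, 0 ≤ s κ) :
    ∑ k : Fin (3 * t) → Bool, p (outcome t k 0) * q (outcome t k 1) * s (outcome t k 2) ≤
      (∑ κ ∈ Finset.range (2 ^ t), p κ) * (∑ κ ∈ Finset.range (2 ^ t), q κ) *
        ∑ κ ∈ Finset.range (2 ^ t), s κ := by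
  rw [Finset.sum_mul_sum, ← Finset.sum_product', Finset.sum_mul_sum, ← Finset.sum_product']
  have hinj : Function.Injective fun k : Fin (3 * t) → Bool =>
      ((outcome t k 0, outcome t k 1), outcome t k 2) := by
    intro k k' h
    simp only [Prod.mk.injEq] at h
    refine outcome_injective t k k' fun r hr => ?_
    interval_cases r
    exacts [h.1.1, h.1.2, h.2]
  have e := Finset.sum_map Finset.univ ⟨_, hinj⟩
    (fun x : (ℕ × ℕ) × ℕ => p x.1.1 * q x.1.2 * s x.2)
  simp only [Function.Embedding.coeFn_mk] at e
  rw [← e]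
  refine Finset.sum_le_sum_of_subset_of_nonneg ?_ fun x _ _ =>
    mul_nonneg (mul_nonneg (hp _) (hq _)) (hs _)
  intro x hx
  obtain ⟨k, -, rfl⟩ := Finset.mem_map.mp hx
  simp [outcome_lt]

/-- The estimate that three rounds of phase estimation give. -/
noncomputable def estimate (t : ℕ) (k : Fin a → Bool) : ℝ :=
  median (-(phaseValue t (outcome t k 0)).re) (-(phaseValue t (outcome t k 1)).re)
    (-(phaseValue t (outcome t k 2)).re)

/-- By the bound on the median, each of the three terms charges √(error) to two rounds and nothing
to the third. Each charged round gives at most 10 · `tailConst` / √(2^t), the other at most 10 ·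
`tailConst`; so the two half powers combine to 2^(-t), and 3000 = 3 · 10³. -/
theorem sum_estimate_le (t : ℕ) (c : ℂ) (hc : ‖c‖ = 1) :
    ∑ k : Fin (3 * t) → Bool,
      ‖∏ s : Fin (3 * t), estFactor c s (stepPower t s) (stepPhase t s) k‖ ^ 2 *
        |estimate t k + c.re| ≤ 3000 * tailConst ^ 3 / 2 ^ t := by
  set P : ℕ → ℝ := fun κ => ‖estAmp t (c * (phaseValue t κ)⁻¹)‖ ^ 2 with hP
  set E : ℕ → ℝ := fun κ => P κ * Real.sqrt ‖phaseValue t κ - c‖ with hE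
  have hP0 : ∀ κ, 0 ≤ P κ := fun κ => by positivity
  have hE0 : ∀ κ, 0 ≤ E κ := fun κ => by positivity
  have hz : ∀ κ, phaseValue t κ ≠ 0 := fun κ => norm_ne_zero_iff.mp (by simp [norm_phaseValue])
  have hw : ∀ κ, ‖c * (phaseValue t κ)⁻¹‖ = 1 := fun κ => by
    rw [norm_mul, norm_inv, hc, norm_phaseValue]; norm_num
  have hd : ∀ κ, ‖1 - c * (phaseValue t κ)⁻¹‖ = ‖phaseValue t κ - c‖ := fun κ => by
    have : phaseValue t κ - c = phaseValue t κ * (1 - c * (phaseValue t κ)⁻¹) := by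
      have := hz κ
      field_simp
    rw [this, norm_mul, norm_phaseValue, one_mul]
  have hK := sum_weight_le t c hc
  have hPs : ∑ κ ∈ Finset.range (2 ^ t), P κ ≤ 10 * tailConst := by
    refine (Finset.sum_le_sum fun κ _ => norm_estAmp_sq_le t _ (hw κ)).trans ?_
    rw [← Finset.mul_sum]
    simp only [hd]
    linarith
  have hN : 0 < Real.sqrt (2 ^ t : ℝ) := Real.sqrt_pos.mpr (by positivity)
  have hEs : ∑ κ ∈ Finset.range (2 ^ t), E κ ≤ 10 * tailConst / Real.sqrt (2 ^ t) := by
    have : ∀ κ ∈ Finset.range (2 ^ t), E κ ≤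
        10 * weight (1 + 2 ^ t * ‖phaseValue t κ - c‖) / Real.sqrt (2 ^ t) := fun κ _ => by
      have := norm_estAmp_sq_mul_sqrt_le t _ (hw κ)
      rwa [hd] at this
    refine (Finset.sum_le_sum this).trans ?_
    rw [← Finset.sum_div, ← Finset.mul_sum]
    gcongr
  have hK0 := tailConst_nonneg
  have hPs0 : 0 ≤ ∑ κ ∈ Finset.range (2 ^ t), P κ := Finset.sum_nonneg fun κ _ => hP0 κ
  have hEs0 : 0 ≤ ∑ κ ∈ Finset.range (2 ^ t), E κ := Finset.sum_nonneg fun κ _ => hE0 κ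
  have hre : ∀ κ, Real.sqrt |-(phaseValue t κ).re - (-c.re)| ≤ Real.sqrt ‖phaseValue t κ - c‖ := by
    intro κ
    refine Real.sqrt_le_sqrt ?_
    have : -(phaseValue t κ).re - (-c.re) = -(phaseValue t κ - c).re := by
      simp; ring
    rw [this, abs_neg]
    exact Complex.abs_re_le_norm _
  have hpt : ∀ k : Fin (3 * t) → Bool,
      ‖∏ s : Fin (3 * t), estFactor c s (stepPower t s) (stepPhase t s) k‖ ^ 2 *
        |estimate t k + c.re| ≤
      E (outcome t k 0) * E (outcome t k 1) * P (outcome t k 2) +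
      E (outcome t k 0) * P (outcome t k 1) * E (outcome t k 2) +
      P (outcome t k 0) * E (outcome t k 1) * E (outcome t k 2) := by
    intro k
    have e : ‖∏ s : Fin (3 * t), estFactor c s (stepPower t s) (stepPhase t s) k‖ ^ 2 =
        P (outcome t k 0) * P (outcome t k 1) * P (outcome t k 2) := by
      rw [prod_estFactor_eq, Fin.prod_univ_three, norm_mul, norm_mul, mul_pow, mul_pow]
      rfl
    have h := abs_median_sub_le (-(phaseValue t (outcome t k 0)).re)
      (-(phaseValue t (outcome t k 1)).re) (-(phaseValue t (outcome t k 2)).re) (-c.re)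
    rw [sub_neg_eq_add] at h
    have h01 := mul_le_mul (hre (outcome t k 0)) (hre (outcome t k 1)) (Real.sqrt_nonneg _)
      (Real.sqrt_nonneg _)
    have h02 := mul_le_mul (hre (outcome t k 0)) (hre (outcome t k 2)) (Real.sqrt_nonneg _)
      (Real.sqrt_nonneg _)
    have h12 := mul_le_mul (hre (outcome t k 1)) (hre (outcome t k 2)) (Real.sqrt_nonneg _)
      (Real.sqrt_nonneg _)
    have h' : |estimate t k + c.re| ≤ _ := h.trans (add_le_add (add_le_add h01 h02) h12)
    rw [e]
    have hpos : 0 ≤ P (outcome t k 0) * P (outcome t k 1) * P (outcome t k 2) := by positivity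
    refine (mul_le_mul_of_nonneg_left h' hpos).trans (le_of_eq ?_)
    simp only [hE]
    ring
  refine (Finset.sum_le_sum fun k _ => hpt k).trans ?_
  rw [Finset.sum_add_distrib, Finset.sum_add_distrib]
  have key : ∀ u v w : ℝ, 0 ≤ v → 0 ≤ w → u ≤ 10 * tailConst →
      v ≤ 10 * tailConst / Real.sqrt (2 ^ t) → w ≤ 10 * tailConst / Real.sqrt (2 ^ t) →
      u * (v * w) ≤ 1000 * tailConst ^ 3 / 2 ^ t := by
    intro u v w hv hw h1 h2 h3
    calc u * (v * w) ≤ (10 * tailConst) *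
        ((10 * tailConst / Real.sqrt (2 ^ t)) * (10 * tailConst / Real.sqrt (2 ^ t))) := by
          gcongr
      _ = 1000 * tailConst ^ 3 / (Real.sqrt (2 ^ t) * Real.sqrt (2 ^ t)) := by
          field_simp; ring
      _ = _ := by rw [Real.mul_self_sqrt (by positivity)]
  have k1 := key _ _ _ hEs0 hEs0 hPs hEs hEs
  have s1 := sum_outcome_le t E E P hE0 hE0 hP0
  have s2 := sum_outcome_le t E P E hE0 hP0 hE0
  have s3 := sum_outcome_le t P E E hP0 hE0 hE0
  have : 3000 * tailConst ^ 3 / 2 ^ t = 3 * (1000 * tailConst ^ 3 / 2 ^ t) := by ring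
  rw [this]
  nlinarith [k1, s1, s2, s3]

end SwapTest

/-! ### Eigenvectors of the Grover operator and the effect of evaluating `f` -/

namespace SwapTest

variable {n m a : ℕ}

theorem flipFlag_add (ξ ξ' : Sys n) : flipFlag (ξ + ξ') = flipFlag ξ + flipFlag ξ' := rfl

theorem flipFlag_smul (c : ℂ) (ξ : Sys n) : flipFlag (c • ξ) = c • flipFlag ξ := rfl

theorem flipFlag_flip (ξ : Sys n) : flipFlag (flipFlag ξ) = ξ := by
  ext s; simp [flipFlag]

theorem norm_flipFlag (ξ : Sys n) : ‖flipFlag ξ‖ = ‖ξ‖ := by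
  rw [EuclideanSpace.norm_eq, EuclideanSpace.norm_eq, Fintype.sum_prod_type, Fintype.sum_prod_type]
  simp [flipFlag, add_comm]

theorem inner_pairVec (x y x' y' : QState (Fin n)) :
    inner ℂ (pairVec x y) (pairVec x' y') = (inner ℂ x x' + inner ℂ y y') / 2 := by
  have h2 : ((Real.sqrt 2 : ℝ) : ℂ)⁻¹ * ((Real.sqrt 2 : ℝ) : ℂ)⁻¹ = 1 / 2 := by
    rw [← mul_inv]
    norm_cast
    rw [Real.mul_self_sqrt (by norm_num)]
    norm_num
  simp only [PiLp.inner_apply, RCLike.inner_apply, Fintype.sum_prod_type, Fintype.sum_bool]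
  rw [add_div, add_comm, Finset.sum_div, Finset.sum_div]
  congr 1
  · refine Finset.sum_congr rfl fun d _ => ?_
    simp [pairVec]
    linear_combination (x' d * (starRingEnd ℂ) (x d)) * h2
  · refine Finset.sum_congr rfl fun d _ => ?_
    simp [pairVec]
    linear_combination (y' d * (starRingEnd ℂ) (y d)) * h2

theorem flipFlag_pairVec (x y : QState (Fin n)) : flipFlag (pairVec x y) = pairVec y x := by
  ext ⟨fl, d⟩
  cases fl <;> simp [flipFlag, pairVec]

/-- The Grover operator has two eigenvectors that sum to the input state. -/
theorem exists_eigenvectors (x y : QState (Fin n)) (hx : ‖x‖ = 1) (hy : ‖y‖ = 1) (c : ℝ)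
    (hc : inner ℂ x y = (c : ℂ)) :
    ∃ (c₁ c₂ : ℂ) (ξ₁ ξ₂ : Sys n), pairVec x y = ξ₁ + ξ₂ ∧
      (‖c₁‖ = 1 ∧ c₁.re = -c ∧ ‖ξ₁‖ ≤ 1 ∧
        flipFlag ξ₁ - (2 * inner ℂ (pairVec x y) (flipFlag ξ₁)) • pairVec x y = c₁ • ξ₁) ∧
      (‖c₂‖ = 1 ∧ c₂.re = -c ∧ ‖ξ₂‖ ≤ 1 ∧
        flipFlag ξ₂ - (2 * inner ℂ (pairVec x y) (flipFlag ξ₂)) • pairVec x y = c₂ • ξ₂) := by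
  have hc1 : |c| ≤ 1 := by
    have := norm_inner_le_norm (𝕜 := ℂ) x y
    rw [hc, hx, hy, Complex.norm_real] at this
    simpa using this
  have hc2 : c ^ 2 ≤ 1 := (sq_le_one_iff_abs_le_one c).mpr hc1
  have hc' : inner ℂ y x = (c : ℂ) := by
    rw [← inner_conj_symm, hc, Complex.conj_ofReal]
  have hxx : inner ℂ x x = (1 : ℂ) := by rw [inner_self_eq_norm_sq_to_K, hx]; simp
  have hyy : inner ℂ y y = (1 : ℂ) := by rw [inner_self_eq_norm_sq_to_K, hy]; simp
  have f1 : inner ℂ (pairVec x y) (pairVec x y) = (1 : ℂ) := by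
    rw [inner_pairVec, hxx, hyy]; norm_num
  have f2 : inner ℂ (pairVec x y) (flipFlag (pairVec x y)) = (c : ℂ) := by
    rw [flipFlag_pairVec, inner_pairVec, hc, hc']; ring
  have f3 : inner ℂ (flipFlag (pairVec x y)) (pairVec x y) = (c : ℂ) := by
    rw [← inner_conj_symm, f2, Complex.conj_ofReal]
  have n1 : ‖pairVec x y‖ = 1 := by
    have h : ‖pairVec x y‖ ^ 2 = 1 := by rw [@norm_sq_eq_re_inner ℂ, f1]; simp
    exact (pow_eq_one_iff_of_nonneg (norm_nonneg _) two_ne_zero).mp h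
  have n2 : ‖flipFlag (pairVec x y)‖ = 1 := by rw [norm_flipFlag, n1]
  have f4 : inner ℂ (flipFlag (pairVec x y)) (flipFlag (pairVec x y)) = (1 : ℂ) := by
    rw [inner_self_eq_norm_sq_to_K, n2]; simp
  generalize pairVec x y = ψ at *
  -- The operator sends Xψ + μψ to μXψ − (1 + 2cμ)ψ, which is μ(Xψ + μψ) exactly when μ solves this
  -- equation.
  have heig : ∀ μ κ : ℂ, μ * μ = -2 * c * μ - 1 →
      flipFlag (κ • (flipFlag ψ + μ • ψ)) - (2 * inner ℂ ψ (flipFlag (κ • (flipFlag ψ + μ • ψ)))) • ψ =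
        μ • κ • (flipFlag ψ + μ • ψ) := by
    intro μ κ hμ
    rw [flipFlag_smul, flipFlag_add, flipFlag_smul, flipFlag_flip, inner_smul_right, inner_add_right,
      inner_smul_right, f1, f2]
    have : μ • κ • (flipFlag ψ + μ • ψ) = (μ * κ) • flipFlag ψ + (κ * (μ * μ)) • ψ := by
      rw [smul_smul, smul_add, smul_smul]; congr 2; ring
    rw [this, hμ]
    module
  have hnorm : ∀ μ : ℂ, ‖μ‖ = 1 → μ.re = -c → ‖flipFlag ψ + μ • ψ‖ ^ 2 = 2 - 2 * c ^ 2 := by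
    intro μ h1 h2
    rw [@norm_add_sq ℂ, inner_smul_right, f3, norm_smul, n1, n2, h1]
    simp [h2]
    ring
  -- If c² < 1, there are two roots −c ± iσ, and ψ is the difference of the two vectors Xψ + μψ
  -- divided by 2iσ. If c² = 1, the roots coincide, but then Xψ = cψ and ψ itself is an eigenvector.
  rcases hc2.lt_or_eq with hlt | heq
  · set σ := Real.sqrt (1 - c ^ 2) with hσ
    have hσ2 : σ ^ 2 = 1 - c ^ 2 := Real.sq_sqrt (by linarith)
    have hσ0 : 0 < σ := Real.sqrt_pos.mpr (by linarith)
    have hσC : (σ : ℂ) ^ 2 = 1 - (c : ℂ) ^ 2 := by exact_mod_cast hσ2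
    have hσ0' : (σ : ℂ) ≠ 0 := by exact_mod_cast hσ0.ne'
    have hI := Complex.I_sq
    have hn : ∀ τ : ℝ, τ ^ 2 = 1 - c ^ 2 → ‖(-c + τ * Complex.I : ℂ)‖ = 1 := by
      intro τ hτ
      have : (-c + τ * Complex.I : ℂ) = ((-c : ℝ) : ℂ) + (τ : ℝ) * Complex.I := by push_cast; rfl
      rw [this, Complex.norm_add_mul_I, neg_sq, hτ]
      simp
    have hre : ∀ τ : ℝ, (-c + τ * Complex.I : ℂ).re = -c := by intro τ; simp
    have hsq : ∀ τ : ℝ, τ ^ 2 = 1 - c ^ 2 → (-c + τ * Complex.I : ℂ) * (-c + τ * Complex.I) =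
        -2 * c * (-c + τ * Complex.I) - 1 := by
      intro τ hτ
      have hτ' : (τ : ℂ) ^ 2 = 1 - (c : ℂ) ^ 2 := by exact_mod_cast hτ
      linear_combination (τ : ℂ) ^ 2 * hI - hτ'
    have hle : ∀ τ : ℝ, τ ^ 2 = 1 - c ^ 2 →
        ‖(2 * Complex.I * τ)⁻¹ • (flipFlag ψ + (-c + τ * Complex.I : ℂ) • ψ)‖ ≤ 1 := by
      intro τ hτ
      rw [← sq_le_one_iff₀ (norm_nonneg _), norm_smul, mul_pow, hnorm _ (hn τ hτ) (hre τ)]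
      rw [norm_inv, norm_mul, norm_mul, Complex.norm_two, Complex.norm_I, mul_one,
        Complex.norm_real, inv_pow, mul_pow, Real.norm_eq_abs, sq_abs, hτ,
        inv_mul_le_iff₀ (by linarith)]
      linarith
    have hσ3 : (-σ) ^ 2 = 1 - c ^ 2 := by rw [neg_sq, hσ2]
    refine ⟨-c + σ * Complex.I, -c + (-σ : ℝ) * Complex.I,
      (2 * Complex.I * σ)⁻¹ • (flipFlag ψ + (-c + σ * Complex.I : ℂ) • ψ),
      (2 * Complex.I * (-σ : ℝ))⁻¹ • (flipFlag ψ + (-c + (-σ : ℝ) * Complex.I : ℂ) • ψ), ?_,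
      ⟨hn σ hσ2, hre σ, hle σ hσ2, heig _ _ (hsq σ hσ2)⟩,
      ⟨hn _ hσ3, hre _, hle _ hσ3, heig _ _ (hsq _ hσ3)⟩⟩
    have hinv : (2 * Complex.I * ((-σ : ℝ) : ℂ))⁻¹ = -(2 * Complex.I * σ)⁻¹ := by
      push_cast
      rw [mul_neg, inv_neg]
    have hone : (2 * Complex.I * σ)⁻¹ * (2 * Complex.I * σ) = 1 :=
      inv_mul_cancel₀ (mul_ne_zero (mul_ne_zero two_ne_zero Complex.I_ne_zero) hσ0')
    rw [hinv]
    push_cast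
    generalize (2 * Complex.I * (σ : ℂ))⁻¹ = κ at *
    have : κ • (flipFlag ψ + (-c + σ * Complex.I : ℂ) • ψ) +
        -κ • (flipFlag ψ + (-c + -σ * Complex.I : ℂ) • ψ) = (κ * (2 * Complex.I * σ)) • ψ := by
      module
    rw [this, hone, one_smul]
  · have h0 : flipFlag ψ = (c : ℂ) • ψ := by
      have h := hnorm (-c : ℂ) (by
        rw [norm_neg, Complex.norm_real, Real.norm_eq_abs]
        exact (pow_eq_one_iff_of_nonneg (abs_nonneg c) two_ne_zero).mp
          (by rw [sq_abs, heq])) (by simp)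
      rw [heq] at h
      have h' : flipFlag ψ + (-c : ℂ) • ψ = 0 := norm_eq_zero.mp (by
        have : ‖flipFlag ψ + (-c : ℂ) • ψ‖ ^ 2 = 0 := by rw [h]; ring
        exact pow_eq_zero_iff two_ne_zero |>.mp this)
      rw [neg_smul, ← sub_eq_add_neg, sub_eq_zero] at h'
      exact h'
    have hcn : ‖(-c : ℂ)‖ = 1 := by
      rw [norm_neg, Complex.norm_real, Real.norm_eq_abs]
      exact (pow_eq_one_iff_of_nonneg (abs_nonneg c) two_ne_zero).mp (by rw [sq_abs, heq])
    refine ⟨-c, -c, ψ, 0, (add_zero ψ).symm, ⟨hcn, by simp, n1.le, ?_⟩, hcn, by simp, by simp, ?_⟩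
    · rw [f2, h0]
      module
    · have : flipFlag (0 : Sys n) = 0 := rfl
      simp [this]

/-- The weight of the ancilla content `k` in a sum of two product vectors. -/
noncomputable def ancWeight (ξ₁ ξ₂ : Sys n) (α₁ α₂ : (Fin a → Bool) → ℂ) (k : Fin a → Bool) : ℝ :=
  ∑ s, ‖ξ₁ s * α₁ k + ξ₂ s * α₂ k‖ ^ 2

theorem ancWeight_nonneg (ξ₁ ξ₂ : Sys n) (α₁ α₂ : (Fin a → Bool) → ℂ) (k : Fin a → Bool) :
    0 ≤ ancWeight ξ₁ ξ₂ α₁ α₂ k := Finset.sum_nonneg fun _ _ => by positivity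

/-- The bound (p + q)² ≤ 2(p² + q²) avoids orthogonality of the two eigenvectors and costs only a
constant. -/
theorem ancWeight_le (ξ₁ ξ₂ : Sys n) (α₁ α₂ : (Fin a → Bool) → ℂ) (h₁ : ‖ξ₁‖ ≤ 1)
    (h₂ : ‖ξ₂‖ ≤ 1) (k : Fin a → Bool) :
    ancWeight ξ₁ ξ₂ α₁ α₂ k ≤ 2 * (‖α₁ k‖ ^ 2 + ‖α₂ k‖ ^ 2) := by
  have e : ancWeight ξ₁ ξ₂ α₁ α₂ k = ‖α₁ k • ξ₁ + α₂ k • ξ₂‖ ^ 2 := by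
    rw [EuclideanSpace.norm_sq_eq]
    refine Finset.sum_congr rfl fun s _ => ?_
    simp [mul_comm]
  have h : ‖α₁ k • ξ₁ + α₂ k • ξ₂‖ ≤ ‖α₁ k‖ + ‖α₂ k‖ := by
    refine (norm_add_le _ _).trans ?_
    rw [norm_smul, norm_smul]
    exact add_le_add (mul_le_of_le_one_right (norm_nonneg _) h₁)
      (mul_le_of_le_one_right (norm_nonneg _) h₂)
  rw [e]
  have := pow_le_pow_left₀ (norm_nonneg _) h 2
  nlinarith [sq_nonneg (‖α₁ k‖ - ‖α₂ k‖)]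

/-- A sum of two product vectors, with `z` in the output register. -/
noncomputable def twoState (ξ₁ ξ₂ : Sys n) (α₁ α₂ : (Fin a → Bool) → ℂ) (z : Fin m → Bool) :
    QState (Wire n m a) :=
  tens ξ₁ (fun o k => if o = z then α₁ k else 0) + tens ξ₂ (fun o k => if o = z then α₂ k else 0)

theorem norm_twoState_sq (ξ₁ ξ₂ : Sys n) (α₁ α₂ : (Fin a → Bool) → ℂ) (z : Fin m → Bool) :
    ‖twoState ξ₁ ξ₂ α₁ α₂ z‖ ^ 2 = ∑ k, ancWeight ξ₁ ξ₂ α₁ α₂ k := by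
  rw [EuclideanSpace.norm_sq_eq, sum_wire]
  simp only [ancWeight]
  rw [Finset.sum_comm (s := (Finset.univ : Finset (Fin a → Bool)))]
  refine Finset.sum_congr rfl fun s _ => ?_
  rw [Finset.sum_eq_single z]
  · refine Finset.sum_congr rfl fun k _ => ?_
    simp [twoState, tens_apply, wireEquiv]
  · intro o _ ho
    refine Finset.sum_eq_zero fun k _ => ?_
    simp [twoState, tens_apply, wireEquiv, ho]
  · simp

/-- Ancilla contents that decode to σ contribute nothing. Any other content k contributes two copies
of the same vector, at the output values f(dec k) and f(σ): these are orthogonal or cancel, so the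
squared norm is at most twice the weight. -/
theorem norm_eval_sub_sq_le (Px Py : QCircuit (Fin n)) (f : ℝ → (Fin m → Bool)) (ξ₁ ξ₂ : Sys n)
    (α₁ α₂ : (Fin a → Bool) → ℂ) (dec : (Fin a → Bool) → ℝ) (σ : ℝ) :
    ‖(Instr.eval dec).act Px Py f (twoState ξ₁ ξ₂ α₁ α₂ fun _ => false) -
      twoState ξ₁ ξ₂ α₁ α₂ (f σ)‖ ^ 2 ≤
      2 * ∑ k, if dec k ≠ σ then ancWeight ξ₁ ξ₂ α₁ α₂ k else 0 := by
  rw [EuclideanSpace.norm_sq_eq, sum_wire, Finset.mul_sum]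
  have hpt : ∀ s o k, ‖((Instr.eval dec).act Px Py f (twoState ξ₁ ξ₂ α₁ α₂ fun _ => false) -
      twoState ξ₁ ξ₂ α₁ α₂ (f σ)) ((wireEquiv n m a).symm (s, (o, k)))‖ ^ 2 ≤
      (if dec k ≠ σ then ‖ξ₁ s * α₁ k + ξ₂ s * α₂ k‖ ^ 2 else 0) *
        ((if o = f (dec k) then 1 else 0) + if o = f σ then 1 else 0) := by
    intro s o k
    have hx : (fun j => xor (o j) (f (dec k) j)) = (fun _ => false) ↔ o = f (dec k) := by
      simp [funext_iff]
    have e : ((Instr.eval dec).act Px Py f (twoState ξ₁ ξ₂ α₁ α₂ fun _ => false) -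
        twoState ξ₁ ξ₂ α₁ α₂ (f σ)) ((wireEquiv n m a).symm (s, (o, k))) =
        (if o = f (dec k) then ξ₁ s * α₁ k + ξ₂ s * α₂ k else 0) -
          (if o = f σ then ξ₁ s * α₁ k + ξ₂ s * α₂ k else 0) := by
      have h1 : (Instr.eval dec).act Px Py f (twoState ξ₁ ξ₂ α₁ α₂ fun _ => false)
          ((wireEquiv n m a).symm (s, (o, k))) =
          if o = f (dec k) then ξ₁ s * α₁ k + ξ₂ s * α₂ k else 0 := by
        change ξ₁ s * (if (fun j => xor (o j) (f (dec k) j)) = (fun _ => false) then α₁ k else 0) +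
          ξ₂ s * (if (fun j => xor (o j) (f (dec k) j)) = (fun _ => false) then α₂ k else 0) = _
        simp only [hx]
        split_ifs <;> ring
      have h2 : twoState ξ₁ ξ₂ α₁ α₂ (f σ) ((wireEquiv n m a).symm (s, (o, k))) =
          if o = f σ then ξ₁ s * α₁ k + ξ₂ s * α₂ k else 0 := by
        change ξ₁ s * (if o = f σ then α₁ k else 0) + ξ₂ s * (if o = f σ then α₂ k else 0) = _
        split_ifs <;> ring
      rw [PiLp.sub_apply, h1, h2]
    rw [e]
    by_cases hd : dec k = σ
    · simp [hd]
    · have h0 : 0 ≤ ‖ξ₁ s * α₁ k + ξ₂ s * α₂ k‖ ^ 2 := by positivity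
      rw [if_pos hd]
      split_ifs
      · simp
      · simp
      · rw [zero_sub, norm_neg, zero_add, mul_one]
      · simp
  refine (Finset.sum_le_sum fun s _ => Finset.sum_le_sum fun o _ => Finset.sum_le_sum fun k _ =>
    hpt s o k).trans (le_of_eq ?_)
  have hsum : ∀ s, (∑ o, ∑ k, (if dec k ≠ σ then ‖ξ₁ s * α₁ k + ξ₂ s * α₂ k‖ ^ 2 else 0) *
      ((if o = f (dec k) then (1 : ℝ) else 0) + if o = f σ then 1 else 0)) =
      ∑ k, (if dec k ≠ σ then ‖ξ₁ s * α₁ k + ξ₂ s * α₂ k‖ ^ 2 else 0) * 2 := by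
    intro s
    rw [Finset.sum_comm]
    refine Finset.sum_congr rfl fun k _ => ?_
    rw [← Finset.mul_sum, Finset.sum_add_distrib]
    simp
    norm_num
  rw [Finset.sum_congr rfl fun s _ => hsum s, Finset.sum_comm]
  refine Finset.sum_congr rfl fun k _ => ?_
  rw [← Finset.sum_mul, mul_comm]
  congr 1
  split_ifs
  · rfl
  · simp

end SwapTest

/-! ### Running time and total error of the algorithm -/

namespace SwapTest

variable {n m a : ℕ}

theorem norm_of_prepares (P : QCircuit (Fin n)) (x : QState (Fin n)) (h : P.Prepares x) :
    ‖x‖ = 1 := by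
  obtain ⟨U, hU, -⟩ := P.exists_isometryEquiv
  rw [← h, ← hU, LinearIsometryEquiv.norm_map]
  simp

section cost

variable (Px Py : QCircuit (Fin n))

theorem cost_flagCall_le (which : Bool) :
    (flagCall which : Instr n m a).cost Px Py ≤ 2 * (if which then Py else Px).cost := by
  have := QCircuit.cost_place_le (dataEmb n m a) {.flag} (by simp [dataEmb])
    (if which then Py else Px)
  simpa [flagCall, Instr.cost, callCircuit] using this

theorem listCost_prepList_le :
    listCost Px Py (prepList n m a) ≤ n + 4 + 2 * Px.cost + 2 * Py.cost := by
  have h1 : listCost Px Py ((List.finRange n).map dataNot : List (Instr n m a)) = n := by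
    simp [listCost, Function.comp_def, dataNot, Instr.cost, QGate.cost]
  have h2 : ∀ M, (flagGate M : Instr n m a).cost Px Py = 1 := fun M => by
    simp [flagGate, Instr.cost, QGate.cost]
  have h3 := cost_flagCall_le (m := m) (a := a) Px Py true
  have h4 := cost_flagCall_le (m := m) (a := a) Px Py false
  simp only [if_true] at h3
  simp only [Bool.false_eq_true, if_false] at h4
  simp only [prepList, listCost_append, listCost_cons, listCost_nil, h1, h2]
  omega

theorem listCost_groverList_le (q : Fin a) :
    listCost Px Py (groverList q : List (Instr n m a)) ≤
      3 * n + 12 + 4 * Px.cost + 4 * Py.cost := by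
  have h1 : (controlledNot q : Instr n m a).cost Px Py = 2 := by
    simp [controlledNot, Instr.cost, QGate.cost]
  have h2 : (controlledSign q : Instr n m a).cost Px Py ≤ n + 2 := by
    have h := Finset.card_insert_le (Wire.anc q : Wire n m a) (Finset.univ.image .data)
    have h' : (Finset.univ.image (Wire.data : Fin n → Wire n m a)).card ≤ n :=
      Finset.card_image_le.trans (by simp)
    simp only [controlledSign, Instr.cost, QGate.cost]
    omega
  have h3 := listCost_prepList_le (m := m) (a := a) Px Py
  simp only [groverList, listCost_append, listCost_cons, listCost_inverseList, h1]
  omega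

theorem listCost_estStep_le (s : Fin a) (p : ℕ) (ω : ℕ → Circle) :
    listCost Px Py (estStep n m s p ω) ≤
      p * (3 * n + 12 + 4 * Px.cost + 4 * Py.cost) + (2 * s + 2) := by
  have h1 : (ancGate ∅ s (Finset.notMem_empty s) hadamardMatrix : Instr n m a).cost Px Py = 1 := by
    simp [ancGate, Instr.cost, QGate.cost]
  have h2 : listCost Px Py ((List.replicate p (groverList s)).flatten : List (Instr n m a)) =
      p * listCost Px Py (groverList s : List (Instr n m a)) := by
    induction p with
    | zero => simp [listCost_nil]
    | succ p ih => rw [List.replicate_succ, List.flatten_cons, listCost_append, ih]; ring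
  have h3 : listCost Px Py ((List.finRange s).map (fun l => ancGate {Fin.castLE s.isLt.le l} s
        (by simp [Fin.ext_iff, l.isLt.ne']) (phaseMatrix (ω l))) : List (Instr n m a)) = s * 2 := by
    simp [listCost, Function.comp_def, ancGate, Instr.cost, QGate.cost]
  have h4 := Nat.mul_le_mul_left p (listCost_groverList_le (m := m) Px Py s)
  simp only [estStep, listCost_append, listCost_cons, listCost_nil, h1, h2, h3]
  omega

theorem listCost_estList (p : ℕ → ℕ) (ω : ℕ → ℕ → Circle) :
    listCost Px Py (estList n m p ω a le_rfl) =
      ∑ s : Fin a, listCost Px Py (estStep n m s (p s) (ω s)) := by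
  rw [estList, Fin.sum_univ_def]
  generalize List.finRange a = L
  induction L with
  | nil => simp [listCost_nil]
  | cons s L ih => rw [List.flatMap_cons, listCost_append, ih]; simp

theorem sum_stepPower_le (t : ℕ) : ∑ s : Fin (3 * t), stepPower t s ≤ 3 * 2 ^ t := by
  rw [← finProdFinEquiv.sum_comp, Fintype.sum_prod_type]
  have : ∀ (r : Fin 3) (i : Fin t), stepPower t (finProdFinEquiv (r, i)) =
      (fun i : ℕ => 2 ^ (t - 1 - i)) i := by
    intro r i
    simp [stepPower, finProdFinEquiv, Nat.mod_eq_of_lt i.isLt]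
  simp only [this]
  rw [← Finset.sum_range (fun i : ℕ => 2 ^ (t - 1 - i)), Finset.sum_range_reflect (fun j => 2 ^ j) t]
  simp only [Finset.sum_const, Finset.card_univ, Fintype.card_fin, smul_eq_mul]
  exact Nat.mul_le_mul_left 3 (Nat.geomSum_lt le_rfl fun _ h => Finset.mem_range.mp h).le

/-- The phase gates between ancillas cost O(t²); this absorbs them into the cost of the Grover
operators. -/
theorem sq_le_two_mul_two_pow (t : ℕ) : t ^ 2 ≤ 2 * 2 ^ t := by
  induction t with
  | zero => simp
  | succ t ih =>
    rcases Nat.lt_or_ge t 3 with h | h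
    · interval_cases t <;> norm_num
    · rw [pow_succ 2 t]; nlinarith

theorem listCost_est_le (t : ℕ) :
    listCost Px Py (estList n m (stepPower t) (stepPhase t) (3 * t) le_rfl) ≤
      2 ^ t * (9 * n + 78 + 12 * Px.cost + 12 * Py.cost) := by
  rw [listCost_estList]
  refine (Finset.sum_le_sum fun s _ => (listCost_estStep_le Px Py s _ _).trans
    (Nat.add_le_add_left (?_ : _ ≤ 6 * t) _)).trans ?_
  · have := s.isLt
    omega
  · rw [Finset.sum_add_distrib, ← Finset.sum_mul, Finset.sum_const, Finset.card_univ,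
      Fintype.card_fin, smul_eq_mul]
    have h1 := Nat.mul_le_mul_right (3 * n + 12 + 4 * Px.cost + 4 * Py.cost) (sum_stepPower_le t)
    have h2 := sq_le_two_mul_two_pow t
    nlinarith

end cost

theorem runList_est (Px Py : QCircuit (Fin n)) (f : ℝ → (Fin m → Bool)) (x y : QState (Fin n))
    (hx : Px.Prepares x) (hy : Py.Prepares y) (c₁ c₂ : ℂ) (ξ₁ ξ₂ : Sys n)
    (hsum : pairVec x y = ξ₁ + ξ₂)
    (h₁ : flipFlag ξ₁ - (2 * inner ℂ (pairVec x y) (flipFlag ξ₁)) • pairVec x y = c₁ • ξ₁)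
    (h₂ : flipFlag ξ₂ - (2 * inner ℂ (pairVec x y) (flipFlag ξ₂)) • pairVec x y = c₂ • ξ₂)
    (p : ℕ → ℕ) (ω : ℕ → ℕ → Circle) (z : Fin m → Bool) :
    runList Px Py f (estList n m p ω a le_rfl) (pairState x y z) =
      twoState ξ₁ ξ₂ (fun k => ∏ s : Fin a, estFactor c₁ s (p s) (ω s) k)
        (fun k => ∏ s : Fin a, estFactor c₂ s (p s) (ω s) k) z := by
  obtain ⟨U, hU, -⟩ := exists_isometryEquiv Px Py f (estList n m p ω a le_rfl)
  have e : tens (pairVec x y) (startFun m a z) =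
      tens ξ₁ (startFun m a z) + tens ξ₂ (startFun m a z) := by
    rw [hsum]; ext b; simp [tens_apply, add_mul]
  rw [pairState_eq_tens, e, ← hU, map_add, hU, hU, runList_estList Px Py f x y hx hy ξ₁ c₁ h₁,
    runList_estList Px Py f x y hx hy ξ₂ c₂ h₂, twoState]
  have hc : ∀ (o : Fin m → Bool) (k : Fin a → Bool),
      (o = z ∧ ∀ s : Fin a, a ≤ s → k s = false) ↔ o = z :=
    fun o k => and_iff_left fun s hs => absurd s.isLt (not_lt.mpr hs)
  congr 2 <;> funext o k <;> exact if_congr (hc o k) rfl rfl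

/-- The coin flips as a number. -/
noncomputable def coinEquiv (q : ℕ) : (Fin q → Bool) ≃ Fin (2 ^ q) :=
  Fintype.equivFinOfCardEq (by simp)

/-- The generalized swap test: phase estimation, evaluation of `f` at the rounded estimate of the
inner product, and phase estimation backwards. The coins determine the shift of the grid. -/
noncomputable def swapTest (n m q t : ℕ) (ε : ℝ) : Algorithm n m where
  coins := q
  anc := 3 * t
  prog r := estList n m (stepPower t) (stepPhase t) (3 * t) le_rfl ++
    (Instr.eval fun k => gridRound (2 ^ q) ε (coinEquiv q r) (estimate t k)) ::
      inverseList (estList n m (stepPower t) (stepPhase t) (3 * t) le_rfl)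

theorem time_swapTest_le (q t : ℕ) (ε : ℝ) (Px Py : QCircuit (Fin n)) (r : Fin q → Bool) :
    (swapTest n m q t ε).time Px Py r ≤
      2 ^ q + 2 ^ t * (18 * n + 160 + 24 * Px.cost + 24 * Py.cost) := by
  have h := listCost_est_le (m := m) Px Py t
  have h1 : (swapTest n m q t ε).time Px Py r = q + 3 * t + listCost Px Py
      (estList n m (stepPower t) (stepPhase t) (3 * t) le_rfl ++
    (Instr.eval fun k => gridRound (2 ^ q) ε (coinEquiv q r) (estimate t k)) ::
      inverseList (estList n m (stepPower t) (stepPhase t) (3 * t) le_rfl)) := rfl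
  rw [h1, listCost_append, listCost_cons, listCost_inverseList]
  have h2 : ∀ dec, (Instr.eval dec : Instr n m (3 * t)).cost Px Py = 1 := fun _ => rfl
  rw [h2]
  have h3 := (Nat.lt_two_pow_self (n := q)).le
  have h4 := (Nat.lt_two_pow_self (n := t))
  nlinarith

theorem card_shift_ne_le (q : ℕ) (ε : ℝ) (hε : 0 < ε) (v w : ℝ) :
    ∑ r : Fin q → Bool, (if gridRound (2 ^ q) ε (coinEquiv q r) v ≠
      gridRound (2 ^ q) ε (coinEquiv q r) w then (1 : ℝ) else 0) ≤ 2 ^ q * |v - w| / ε + 1 := by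
  rw [(coinEquiv q).sum_comp (fun j => if gridRound (2 ^ q) ε j v ≠ gridRound (2 ^ q) ε j w then
      (1 : ℝ) else 0), Fin.sum_univ_eq_sum_range (fun j => if gridRound (2 ^ q) ε j v ≠
        gridRound (2 ^ q) ε j w then (1 : ℝ) else 0), ← Finset.sum_filter, Finset.sum_const,
    nsmul_eq_mul, mul_one]
  simpa using card_gridRound_ne_le (2 ^ q) (by positivity) ε hε v w

/-- For each shift the squared error is at most twice the weight of the contents whose estimate
rounds differently from c. Exchanging the sums, the average over shifts bounds each content's share
by |estimate − c|/ε + 2^(-q), and the mean error of the estimate finishes the bound. -/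
theorem error_swapTest_le (q t : ℕ) (ε : ℝ) (hε : 0 < ε) (Px Py : QCircuit (Fin n))
    (x y : QState (Fin n)) (hx : Px.Prepares x) (hy : Py.Prepares y) (c : ℝ)
    (hc : inner ℂ x y = (c : ℂ)) (f : ℝ → (Fin m → Bool)) :
    (∑ r : Fin q → Bool, ‖(swapTest n m q t ε).run Px Py f r (pairState x y fun _ => false) -
      pairState x y (f (gridRound (2 ^ q) ε (coinEquiv q r) c))‖ ^ 2) / 2 ^ q ≤
      24000 * tailConst ^ 3 / (2 ^ t * ε) + 2 / 2 ^ q := by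
  have hxn := norm_of_prepares Px x hx
  have hyn := norm_of_prepares Py y hy
  obtain ⟨c₁, c₂, ξ₁, ξ₂, hsum, ⟨hc₁, hre₁, hn₁, he₁⟩, hc₂, hre₂, hn₂, he₂⟩ :=
    exists_eigenvectors x y hxn hyn c hc
  set α₁ : (Fin (3 * t) → Bool) → ℂ := fun k => ∏ s : Fin (3 * t),
    estFactor c₁ s (stepPower t s) (stepPhase t s) k with hα₁
  set α₂ : (Fin (3 * t) → Bool) → ℂ := fun k => ∏ s : Fin (3 * t),
    estFactor c₂ s (stepPower t s) (stepPhase t s) k with hα₂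
  obtain ⟨U, hU, hU'⟩ := exists_isometryEquiv Px Py f
    (estList n m (stepPower t) (stepPhase t) (3 * t) le_rfl)
  have hest : ∀ z, U (pairState x y z) = twoState ξ₁ ξ₂ α₁ α₂ z := fun z => by
    rw [hU]
    exact runList_est Px Py f x y hx hy c₁ c₂ ξ₁ ξ₂ hsum he₁ he₂ _ _ z
  set P := ancWeight ξ₁ ξ₂ α₁ α₂ with hP
  have hP0 : ∀ k, 0 ≤ P k := ancWeight_nonneg ξ₁ ξ₂ α₁ α₂
  -- The weights form a probability distribution because phase estimation is unitary and the input
  -- is a unit vector.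
  have hP1 : ∑ k, P k = 1 := by
    rw [← norm_twoState_sq (m := m) ξ₁ ξ₂ α₁ α₂ fun _ => false, ← hest,
      LinearIsometryEquiv.norm_map, pairState_eq_tens, @norm_sq_eq_re_inner ℂ, inner_tens,
      inner_pairVec, inner_self_eq_norm_sq_to_K, inner_self_eq_norm_sq_to_K, hxn, hyn]
    have : ∑ o : Fin m → Bool, ∑ k : Fin (3 * t) → Bool, startFun m (3 * t) (fun _ => false) o k *
        (starRingEnd ℂ) (startFun m (3 * t) (fun _ => false) o k) = 1 := by
      rw [Finset.sum_eq_single fun _ => false, Finset.sum_eq_single fun _ => false] <;>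
        simp +contextual [startFun]
    rw [this]
    norm_num
  -- Both eigenvalues have real part −c, so the two phase estimations approximate the same number;
  -- 12000 = 2 · 2 · 3000.
  have hPest : ∑ k, P k * |estimate t k - c| ≤ 12000 * tailConst ^ 3 / 2 ^ t := by
    have h1 := sum_estimate_le t c₁ hc₁
    have h2 := sum_estimate_le t c₂ hc₂
    rw [hre₁] at h1
    rw [hre₂] at h2
    simp only [← sub_eq_add_neg] at h1 h2
    calc ∑ k, P k * |estimate t k - c| ≤ ∑ k, (2 * (‖α₁ k‖ ^ 2 * |estimate t k - c|) +
          2 * (‖α₂ k‖ ^ 2 * |estimate t k - c|)) := by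
          refine Finset.sum_le_sum fun k _ => ?_
          have := mul_le_mul_of_nonneg_right (ancWeight_le ξ₁ ξ₂ α₁ α₂ hn₁ hn₂ k)
            (abs_nonneg (estimate t k - c))
          refine this.trans (le_of_eq (by ring))
      _ ≤ 2 * (3000 * tailConst ^ 3 / 2 ^ t) + 2 * (3000 * tailConst ^ 3 / 2 ^ t) := by
          rw [Finset.sum_add_distrib, ← Finset.mul_sum, ← Finset.mul_sum]
          gcongr
      _ = _ := by ring
  have hr : ∀ r : Fin q → Bool,
      ‖(swapTest n m q t ε).run Px Py f r (pairState x y fun _ => false) -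
        pairState x y (f (gridRound (2 ^ q) ε (coinEquiv q r) c))‖ ^ 2 ≤
      2 * ∑ k, P k * (if gridRound (2 ^ q) ε (coinEquiv q r) (estimate t k) ≠
        gridRound (2 ^ q) ε (coinEquiv q r) c then 1 else 0) := by
    intro r
    have e1 : (swapTest n m q t ε).run Px Py f r (pairState x y fun _ => false) =
        U.symm ((Instr.eval fun k => gridRound (2 ^ q) ε (coinEquiv q r) (estimate t k)).act
          Px Py f (U (pairState x y fun _ => false))) := by
      rw [hU', hU, ← runList_cons, ← runList_append]
      rfl
    have e2 : ‖U.symm ((Instr.eval fun k => gridRound (2 ^ q) ε (coinEquiv q r)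
          (estimate t k)).act Px Py f (U (pairState x y fun _ => false))) -
        pairState x y (f (gridRound (2 ^ q) ε (coinEquiv q r) c))‖ ^ 2 ≤
        2 * ∑ k, P k * (if gridRound (2 ^ q) ε (coinEquiv q r) (estimate t k) ≠
          gridRound (2 ^ q) ε (coinEquiv q r) c then 1 else 0) := by
      -- The ideal final state is also written as the result of estimating and undoing the
      -- estimation, so the comparison takes place right after the evaluation of `f`.
      rw [← U.symm_apply_apply (pairState x y (f (gridRound (2 ^ q) ε (coinEquiv q r) c))),
        ← map_sub, LinearIsometryEquiv.norm_map, hest, hest]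
      refine (norm_eval_sub_sq_le Px Py f ξ₁ ξ₂ α₁ α₂ _ _).trans (le_of_eq ?_)
      simp only [mul_ite, mul_one, mul_zero]
      rfl
    rw [e1]
    exact e2
  have hM : (0 : ℝ) < 2 ^ q := by positivity
  have hfin : ∑ r : Fin q → Bool,
      ‖(swapTest n m q t ε).run Px Py f r (pairState x y fun _ => false) -
        pairState x y (f (gridRound (2 ^ q) ε (coinEquiv q r) c))‖ ^ 2 ≤
      2 * (2 ^ q / ε * (12000 * tailConst ^ 3 / 2 ^ t) + 1) := by
    refine (Finset.sum_le_sum fun r _ => hr r).trans ?_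
    rw [← Finset.mul_sum, Finset.sum_comm]
    refine mul_le_mul_of_nonneg_left ?_ (by norm_num)
    calc _ ≤ ∑ k, (2 ^ q / ε * (P k * |estimate t k - c|) + P k) := by
          refine Finset.sum_le_sum fun k _ => ?_
          rw [← Finset.mul_sum]
          refine (mul_le_mul_of_nonneg_left (card_shift_ne_le q ε hε (estimate t k) c)
            (hP0 k)).trans (le_of_eq (by ring))
      _ ≤ _ := by
          rw [Finset.sum_add_distrib, ← Finset.mul_sum, hP1]
          gcongr
  rw [div_le_iff₀ hM]
  refine hfin.trans (le_of_eq ?_)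
  field_simp
  ring

theorem exists_two_pow_ge {X : ℝ} (hX : 1 ≤ X) : ∃ k : ℕ, X ≤ 2 ^ k ∧ 2 ^ k ≤ 2 * X := by
  obtain ⟨k, h1, h2⟩ := exists_nat_pow_near hX one_lt_two
  exact ⟨k + 1, h2.le, by rw [pow_succ]; linarith⟩

end SwapTest

/-- Generalized swap test. The algorithm `A` depends on the sizes, the accuracy `ε` and the error
`δ` only; it works for all states `x`, `y` with real inner product (in particular for real states,
up to a common global phase) and for all functions `f`. -/
theorem mainTheorem3 :
    ∃ C : ℝ, 0 < C ∧
      ∀ (n m : ℕ) (ε δ : ℝ), 1 ≤ n → 0 < ε → ε ≤ 1 → 0 < δ → δ ≤ 1 →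
        ∃ A : SwapTest.Algorithm n m,
          ∀ (Px Py : QCircuit (Fin n)) (x y : QState (Fin n)) (T : ℝ),
            Px.Prepares x → Py.Prepares y →
            (Px.prepTime : ℝ) ≤ T → (Py.prepTime : ℝ) ≤ T →
            (inner ℂ x y).im = 0 →
            (∀ r, (A.time Px Py r : ℝ) ≤ C * (T / (ε * δ))) ∧
            ∃ s : (Fin A.coins → Bool) → ℝ,
              (∀ r, ‖inner ℂ x y - (s r : ℂ)‖ ≤ ε) ∧
              ∀ f : ℝ → (Fin m → Bool),
                (∑ r, ‖A.run Px Py f r (SwapTest.pairState x y (fun _ => false)) -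
                    SwapTest.pairState x y (f (s r))‖ ^ 2) / 2 ^ A.coins ≤ δ := by
  have hK := SwapTest.tailConst_nonneg
  -- Twice the constant 24000 of the error bound, so that 2^t ≥ X/(εδ) makes its first term at most
  -- δ/2. The summand 1 ensures X/(εδ) ≥ 1.
  set X : ℝ := 48000 * SwapTest.tailConst ^ 3 + 1 with hX
  have hX1 : 1 ≤ X := by
    have : 0 ≤ 48000 * SwapTest.tailConst ^ 3 := by positivity
    linarith
  -- The 8 comes from 2^q ≤ 8/δ, the 2X from 2^t ≤ 2X/(εδ), and 208 = 48 + 160 bounds the remaining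
  -- cost by T, using 1 ≤ n ≤ T.
  refine ⟨8 + 2 * X * 208, by positivity, ?_⟩
  intro n m ε δ hn hε hε1 hδ hδ1
  have hεδ : 0 < ε * δ := mul_pos hε hδ
  have hεδ1 : ε * δ ≤ 1 := mul_le_one₀ hε1 hδ.le hδ1
  -- 2^q ≥ 4/δ makes the second error term 2/2^q at most δ/2.
  obtain ⟨q, hq1, hq2⟩ := SwapTest.exists_two_pow_ge (X := 4 / δ)
    (by rw [le_div_iff₀ hδ]; linarith)
  obtain ⟨t, ht1, ht2⟩ := SwapTest.exists_two_pow_ge (X := X / (ε * δ))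
    (by rw [le_div_iff₀ hεδ]; linarith)
  refine ⟨SwapTest.swapTest n m q t ε, ?_⟩
  intro Px Py x y T hx hy hTx hTy him
  set c : ℝ := (inner ℂ x y).re with hc
  have hcc : inner ℂ x y = (c : ℂ) := Complex.ext rfl (by simpa using him)
  have hTx' : (n : ℝ) + Px.cost ≤ T := by
    simpa [QCircuit.prepTime] using hTx
  have hTy' : (n : ℝ) + Py.cost ≤ T := by
    simpa [QCircuit.prepTime] using hTy
  have hn1 : (1 : ℝ) ≤ n := by exact_mod_cast hn
  have hT1 : 1 ≤ T := by
    have : (0 : ℝ) ≤ Px.cost := Nat.cast_nonneg _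
    linarith
  refine ⟨fun r => ?_, fun r => SwapTest.gridRound (2 ^ q) ε (SwapTest.coinEquiv q r) c,
    fun r => ?_, fun f => ?_⟩
  · have h : ((SwapTest.swapTest n m q t ε).time Px Py r : ℝ) ≤
        2 ^ q + 2 ^ t * (18 * n + 160 + 24 * Px.cost + 24 * Py.cost) := by
      exact_mod_cast SwapTest.time_swapTest_le q t ε Px Py r
    have h1 : (2 : ℝ) ^ q ≤ 8 * (T / (ε * δ)) := by
      refine hq2.trans ?_
      rw [← mul_div_assoc, ← mul_div_assoc, div_le_div_iff₀ hδ hεδ]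
      have : ε * δ ≤ T * δ := mul_le_mul_of_nonneg_right (hε1.trans hT1) hδ.le
      linarith
    have h2 : (18 * n + 160 + 24 * Px.cost + 24 * Py.cost : ℝ) ≤ 208 * T := by
      linarith
    calc _ ≤ _ := h
      _ ≤ 8 * (T / (ε * δ)) + 2 * (X / (ε * δ)) * (208 * T) := by gcongr
      _ = _ := by ring
  · rw [hcc, ← Complex.ofReal_sub, Complex.norm_real]
    exact SwapTest.abs_sub_gridRound_le (2 ^ q) (by positivity) ε hε _ c
  · refine (SwapTest.error_swapTest_le q t ε hε Px Py x y hx hy c hcc f).trans ?_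
    have h1 : 24000 * SwapTest.tailConst ^ 3 / (2 ^ t * ε) ≤ δ / 2 := by
      rw [div_le_div_iff₀ (by positivity) two_pos]
      rw [div_le_iff₀ hεδ] at ht1
      nlinarith
    have h2 : (2 : ℝ) / 2 ^ q ≤ δ / 2 := by
      rw [div_le_div_iff₀ (by positivity) two_pos]
      rw [div_le_iff₀ hδ] at hq1
      linarith
    linarith
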